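/- Let $k$ be a field and let $A$, $B$ be finite-dimensional Hopf algebras over $k$ that form a matched pair. That is: there are coalgebra maps $\triangleright: B\otimes A\to A$ and $\triangleleft: B\otimes A\to B$ such that $\triangleright$ is a left action of the algebra $B$ on $A$, $\triangleleft$ is a right action of the algebra $A$ on $B$, and for all $a,a'\in A$, $b,b'\in B$ (Sweedler notation) $$b\triangleright(aa')=\sum (b_1\triangleright a_1)\bigl((b_2\triangleleft a_2)\triangleright a'\bigr),\qquad b\triangleright 1=\varepsilon(b)1,$$ $$(bb')\triangleleft a=\sum \bigl(b\triangleleft(b'_1\triangleright a_1)\bigr)(b'_2\triangleleft a_2),\qquad 1\triangleleft a=\varepsilon(a)1,$$ $$\sum (b_1\triangleleft a_1)\otimes(b_2\triangleright a_2)=\sum (b_2\triangleleft a_2)\otimes(b_1\triangleright a_1).$$ Let $H=A\bowtie B$ be their double cross product: the space $A\otimes B$ with unit $1\bowtie 1$ and product $$(a\bowtie b)(a'\bowtie b')=\sum a(b_1\triangleright a'_1)\bowtie(b_2\triangleleft a'_2)b',$$ which contains $A$ and $B$ through $a\mapsto a\bowtie 1$ and $b\mapsto 1\bowtie b$. For a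 ring extension $R\hookrightarrow S$ put $S^{\otimes_R 0}=R$ and let $S^{\otimes_R n}$ be the $n$-fold tensor product of $S$ over $R$ for $n\ge 1$. Two bimodules $M,N$ are similar, $M\sim N$, if $M$ is isomorphic to a direct summand of $N^{p}$ and $N$ to a direct summand of $M^{q}$ for some positive integers $p,q$. The extension satisfies the depth $2n+1$ condition ($n\ge 0$) if $S^{\otimes_R(n+1)}\sim S^{\otimes_R n}$ as $R$-$R$-bimodules, and the depth $2n$ condition ($n\ge 1$) if $S^{\otimes_R(n+1)}\sim S^{\otimes_R n}$ as $R$-$S$-bimodules or as $S$-$R$-bimodules. The minimum depth $d(R,S)\in\{1,2,\dots\}\cup\{\infty\}$ is the least $m$ for which the depth $m$ condition holds ($\infty$ if there is none). Then: 1. $d(A,H)\le 2$ if and only if the action $B\triangleleft A$ is trivial, i.e. $b\triangleleft a=\varepsilon(a)\,b$ for all $a\in A$, $b\in B$; 2. $d(B,H)\le 2$ if and only if the action $B\triangleright A$ is trivial, i.e. $b\triangleright a=\varepsilon(b)\,a$ for all $a\in A$, $b\in B$. -/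

import Mathlib

open scoped TensorProduct

noncomputable section

universe u v w

/-! ## Bimodules, similarity, and the minimum depth of a ring extension -/

/-- An `R`-`S`-bimodule over algebras `R`, `S` over a commutative base ring `k` (for `k = ℤ`
these are the bimodules over rings): a `k`-module with a left action of `R` and a right action of
`S` that commute with each other. -/
structure RSBimodule (k : Type*) [CommRing k] (R : Type*) (S : Type*) [Ring R] [Ring S]
    [Algebra k R] [Algebra k S] where
  carrier : Type w
  [addCommGroup : AddCommGroup carrier]
  [module : Module k carrier]
  /-- `lact r m = r · m` -/
  lact : R →ₐ[k] Module.End k carrier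
  /-- `ract (op s) m = m · s` -/
  ract : Sᵐᵒᵖ →ₐ[k] Module.End k carrier
  lact_ract : ∀ (r : R) (s : Sᵐᵒᵖ) (m : carrier), lact r (ract s m) = ract s (lact r m)

attribute [instance] RSBimodule.addCommGroup RSBimodule.module

namespace RSBimodule

variable {k : Type*} [CommRing k] {R S T R' S' : Type*} [Ring R] [Ring S] [Ring T] [Ring R']
  [Ring S'] [Algebra k R] [Algebra k S] [Algebra k T] [Algebra k R'] [Algebra k S']

/-- The regular bimodule `R` over `R`, `R`. -/
def regular (k : Type*) [CommRing k] (R : Type u) [Ring R] [Algebra k R] :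
    RSBimodule.{u} k R R where
  carrier := R
  lact := Algebra.lmul k R
  ract := Algebra.lsmul k k R
  lact_ract _ _ _ := by simp [mul_assoc]

/-- Restriction of the two actions along algebra homomorphisms. -/
def restrict (M : RSBimodule.{w} k R S) (f : R' →ₐ[k] R) (g : S' →ₐ[k] S) :
    RSBimodule.{w} k R' S' where
  carrier := M.carrier
  lact := M.lact.comp f
  ract := M.ract.comp (AlgHom.op g)
  lact_ract _ _ m := M.lact_ract _ _ m

/-- The direct sum of `p` copies of a bimodule. -/
def copies (p : ℕ) (N : RSBimodule.{w} k R S) : RSBimodule.{w} k R S where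
  carrier := Fin p → N.carrier
  lact := AlgHom.ofLinearMap
    { toFun := fun r => LinearMap.pi fun i => N.lact r ∘ₗ LinearMap.proj i
      map_add' := fun _ _ => by ext; simp
      map_smul' := fun _ _ => by ext; simp }
    (by ext; simp) (fun _ _ => by ext; simp)
  ract := AlgHom.ofLinearMap
    { toFun := fun s => LinearMap.pi fun i => N.ract s ∘ₗ LinearMap.proj i
      map_add' := fun _ _ => by ext; simp
      map_smul' := fun _ _ => by ext; simp }
    (by ext; simp) (fun _ _ => by ext; simp)
  lact_ract r s m := by
    funext i
    exact N.lact_ract r s (m i)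

/-- A `k`-linear map that is a homomorphism of bimodules. -/
def IsHom (M : RSBimodule.{v} k R S) (N : RSBimodule.{w} k R S)
    (f : M.carrier →ₗ[k] N.carrier) : Prop :=
  (∀ r m, f (M.lact r m) = N.lact r (f m)) ∧ (∀ s m, f (M.ract s m) = N.ract s (f m))

/-- `M ∣ N`: the bimodule `M` is (isomorphic to) a direct summand of `N`, that is, there is a
split monomorphism of bimodules `M → N`. -/
def IsSummand (M : RSBimodule.{v} k R S) (N : RSBimodule.{w} k R S) : Prop :=
  ∃ (i : M.carrier →ₗ[k] N.carrier) (π : N.carrier →ₗ[k] M.carrier),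
    IsHom M N i ∧ IsHom N M π ∧ ∀ m, π (i m) = m

/-- Similarity `M ∼ N` of bimodules: `M ∣ pN` and `N ∣ qM` for some positive integers `p`, `q`. -/
def Similar (M : RSBimodule.{v} k R S) (N : RSBimodule.{w} k R S) : Prop :=
  (∃ p : ℕ, 0 < p ∧ IsSummand M (copies p N)) ∧ (∃ q : ℕ, 0 < q ∧ IsSummand N (copies q M))

/-- The relations `ms ⊗ n = m ⊗ sn` that define the tensor product over `S`. -/
def balancing (M : RSBimodule.{v} k R S) (N : RSBimodule.{w} k S T) :
    Submodule k (M.carrier ⊗[k] N.carrier) :=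
  Submodule.span k {x | ∃ (m : M.carrier) (s : S) (n : N.carrier),
    x = M.ract (MulOpposite.op s) m ⊗ₜ[k] n - m ⊗ₜ[k] N.lact s n}

theorem balancing_le_left (M : RSBimodule.{v} k R S) (N : RSBimodule.{w} k S T) (r : R) :
    balancing M N ≤ (balancing M N).comap (LinearMap.rTensor N.carrier (M.lact r)) := by
  refine Submodule.span_le.2 ?_
  rintro _ ⟨m, s, n, rfl⟩
  refine Submodule.subset_span ⟨M.lact r m, s, n, ?_⟩
  simp [M.lact_ract]

theorem balancing_le_right (M : RSBimodule.{v} k R S) (N : RSBimodule.{w} k S T) (t : Tᵐᵒᵖ) :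
    balancing M N ≤ (balancing M N).comap (LinearMap.lTensor M.carrier (N.ract t)) := by
  refine Submodule.span_le.2 ?_
  rintro _ ⟨m, s, n, rfl⟩
  refine Submodule.subset_span ⟨m, s, N.ract t n, ?_⟩
  simp [N.lact_ract]

/-- `r (m ⊗ n) = rm ⊗ n` -/
def tensorLact (M : RSBimodule.{v} k R S) (N : RSBimodule.{w} k S T) (r : R) :
    Module.End k ((M.carrier ⊗[k] N.carrier) ⧸ balancing M N) :=
  (balancing M N).mapQ (balancing M N) (LinearMap.rTensor N.carrier (M.lact r))
    (balancing_le_left M N r)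

/-- `(m ⊗ n) t = m ⊗ nt` -/
def tensorRact (M : RSBimodule.{v} k R S) (N : RSBimodule.{w} k S T) (t : Tᵐᵒᵖ) :
    Module.End k ((M.carrier ⊗[k] N.carrier) ⧸ balancing M N) :=
  (balancing M N).mapQ (balancing M N) (LinearMap.lTensor M.carrier (N.ract t))
    (balancing_le_right M N t)

theorem tensorLact_mk (M : RSBimodule.{v} k R S) (N : RSBimodule.{w} k S T) (r : R)
    (x : M.carrier ⊗[k] N.carrier) : tensorLact M N r (Submodule.Quotient.mk x) =
      Submodule.Quotient.mk (LinearMap.rTensor N.carrier (M.lact r) x) := rfl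

theorem tensorRact_mk (M : RSBimodule.{v} k R S) (N : RSBimodule.{w} k S T) (t : Tᵐᵒᵖ)
    (x : M.carrier ⊗[k] N.carrier) : tensorRact M N t (Submodule.Quotient.mk x) =
      Submodule.Quotient.mk (LinearMap.lTensor M.carrier (N.ract t) x) := rfl

/-- The left action on `M ⊗_S N`. -/
def tensorLactHom (M : RSBimodule.{v} k R S) (N : RSBimodule.{w} k S T) :
    R →ₐ[k] Module.End k ((M.carrier ⊗[k] N.carrier) ⧸ balancing M N) :=
  AlgHom.ofLinearMap
    { toFun := tensorLact M N
      map_add' := fun r r' => by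
        refine LinearMap.ext fun x => ?_
        obtain ⟨x, rfl⟩ := Submodule.Quotient.mk_surjective _ x
        rw [LinearMap.add_apply, tensorLact_mk, tensorLact_mk, tensorLact_mk, map_add,
          LinearMap.rTensor_add, LinearMap.add_apply, Submodule.Quotient.mk_add]
      map_smul' := fun c r => by
        refine LinearMap.ext fun x => ?_
        obtain ⟨x, rfl⟩ := Submodule.Quotient.mk_surjective _ x
        rw [LinearMap.smul_apply, tensorLact_mk, tensorLact_mk, map_smul,
          LinearMap.rTensor_smul, LinearMap.smul_apply, Submodule.Quotient.mk_smul]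
        rfl }
    (by
      refine LinearMap.ext fun x => ?_
      obtain ⟨x, rfl⟩ := Submodule.Quotient.mk_surjective _ x
      simp only [LinearMap.coe_mk, AddHom.coe_mk, tensorLact_mk, map_one, Module.End.one_apply]
      rw [Module.End.one_eq_id, LinearMap.rTensor_id, LinearMap.id_apply])
    (fun r r' => by
      refine LinearMap.ext fun x => ?_
      obtain ⟨x, rfl⟩ := Submodule.Quotient.mk_surjective _ x
      simp only [LinearMap.coe_mk, AddHom.coe_mk, tensorLact_mk, map_mul, Module.End.mul_apply]
      rw [LinearMap.rTensor_mul, Module.End.mul_apply])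

/-- The right action on `M ⊗_S N`. -/
def tensorRactHom (M : RSBimodule.{v} k R S) (N : RSBimodule.{w} k S T) :
    Tᵐᵒᵖ →ₐ[k] Module.End k ((M.carrier ⊗[k] N.carrier) ⧸ balancing M N) :=
  AlgHom.ofLinearMap
    { toFun := tensorRact M N
      map_add' := fun r r' => by
        refine LinearMap.ext fun x => ?_
        obtain ⟨x, rfl⟩ := Submodule.Quotient.mk_surjective _ x
        rw [LinearMap.add_apply, tensorRact_mk, tensorRact_mk, tensorRact_mk, map_add,
          LinearMap.lTensor_add, LinearMap.add_apply, Submodule.Quotient.mk_add]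
      map_smul' := fun c r => by
        refine LinearMap.ext fun x => ?_
        obtain ⟨x, rfl⟩ := Submodule.Quotient.mk_surjective _ x
        rw [LinearMap.smul_apply, tensorRact_mk, tensorRact_mk, map_smul,
          LinearMap.lTensor_smul, LinearMap.smul_apply, Submodule.Quotient.mk_smul]
        rfl }
    (by
      refine LinearMap.ext fun x => ?_
      obtain ⟨x, rfl⟩ := Submodule.Quotient.mk_surjective _ x
      simp only [LinearMap.coe_mk, AddHom.coe_mk, tensorRact_mk, map_one, Module.End.one_apply]
      rw [Module.End.one_eq_id, LinearMap.lTensor_id, LinearMap.id_apply])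
    (fun r r' => by
      refine LinearMap.ext fun x => ?_
      obtain ⟨x, rfl⟩ := Submodule.Quotient.mk_surjective _ x
      simp only [LinearMap.coe_mk, AddHom.coe_mk, tensorRact_mk, map_mul, Module.End.mul_apply]
      rw [LinearMap.lTensor_mul, Module.End.mul_apply])

theorem tensorLact_tensorRact (M : RSBimodule.{v} k R S) (N : RSBimodule.{w} k S T) (r : R)
    (t : Tᵐᵒᵖ) (x : (M.carrier ⊗[k] N.carrier) ⧸ balancing M N) :
    tensorLact M N r (tensorRact M N t x) = tensorRact M N t (tensorLact M N r x) := by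
  obtain ⟨x, rfl⟩ := Submodule.Quotient.mk_surjective _ x
  rw [tensorRact_mk, tensorLact_mk, tensorLact_mk, tensorRact_mk, ← LinearMap.comp_apply,
    ← LinearMap.comp_apply, LinearMap.rTensor_comp_lTensor, LinearMap.lTensor_comp_rTensor]

/-- The tensor product `M ⊗_S N` of an `R`-`S`-bimodule and an `S`-`T`-bimodule, an
`R`-`T`-bimodule by `r (m ⊗ n) t = rm ⊗ nt`. -/
def tensor (M : RSBimodule.{v} k R S) (N : RSBimodule.{w} k S T) :
    RSBimodule.{max v w} k R T where
  carrier := (M.carrier ⊗[k] N.carrier) ⧸ balancing M N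
  lact := tensorLactHom M N
  ract := tensorRactHom M N
  lact_ract := tensorLact_tensorRact M N

end RSBimodule

namespace RingExtension

variable {k : Type*} [CommRing k] {B : Type u} {A : Type v} [Ring B] [Ring A] [Algebra k B]
  [Algebra k A]

/-- For a ring extension `ι : B → A`: the `A`-`A`-bimodule `A ⊗_B A ⊗_B ⋯ ⊗_B A` with `n + 1`
factors `A`. -/
def tensorPower (ι : B →ₐ[k] A) : ℕ → RSBimodule.{v} k A A
  | 0 => RSBimodule.regular k A
  | n + 1 => ((tensorPower ι n).restrict (AlgHom.id k A) ι).tensor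
      ((RSBimodule.regular k A).restrict ι (AlgHom.id k A))

/-- The extension satisfies the depth `2n + 1` condition: the `(n+1)`-fold and the `n`-fold tensor
powers of `A` over `B` are similar as `B`-`B`-bimodules; the `0`-fold one is `B`. -/
def OddDepth (ι : B →ₐ[k] A) : ℕ → Prop
  | 0 => ((tensorPower ι 0).restrict ι ι).Similar (RSBimodule.regular k B)
  | n + 1 => ((tensorPower ι (n + 1)).restrict ι ι).Similar ((tensorPower ι n).restrict ι ι)

/-- The extension satisfies the depth `2(n + 1)` condition: the `(n+2)`-fold and the `(n+1)`-fold
tensor powers of `A` over `B` are similar as `B`-`A`-bimodules or as `A`-`B`-bimodules. -/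
def EvenDepth (ι : B →ₐ[k] A) (n : ℕ) : Prop :=
  ((tensorPower ι (n + 1)).restrict ι (AlgHom.id k A)).Similar
      ((tensorPower ι n).restrict ι (AlgHom.id k A)) ∨
    ((tensorPower ι (n + 1)).restrict (AlgHom.id k A) ι).Similar
      ((tensorPower ι n).restrict (AlgHom.id k A) ι)

/-- The minimum depth `d(B, A)` of the ring extension `ι : B → A`: the least `d` for which the
depth `d` condition holds, and `∞` if there is none. -/
def minDepth (ι : B →ₐ[k] A) : ℕ∞ :=
  sInf {d : ℕ∞ | (∃ n : ℕ, d = (2 * n + 1 : ℕ) ∧ OddDepth ι n) ∨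
    (∃ n : ℕ, d = (2 * (n + 1) : ℕ) ∧ EvenDepth ι n)}

end RingExtension

/-! ## Matched pairs of Hopf algebras and their double cross products -/

/-- For coalgebra maps `b ⊗ a ↦ b ▷ a` and `b ⊗ a ↦ b ◁ a`, the map
`b ⊗ a ↦ ∑ (b₁ ▷ a₁) ⊗ (b₂ ◁ a₂)`. (The comultiplication of the coalgebra `B ⊗ A` is
`b ⊗ a ↦ ∑ (b₁ ⊗ a₁) ⊗ (b₂ ⊗ a₂)`.) -/
def crossTwist {k : Type*} [Field k] {A B : Type*} [Ring A] [Ring B] [HopfAlgebra k A]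
    [HopfAlgebra k B] (left : B ⊗[k] A →ₗc[k] A) (right : B ⊗[k] A →ₗc[k] B) :
    B ⊗[k] A →ₗ[k] A ⊗[k] B :=
  TensorProduct.map left.toLinearMap right.toLinearMap ∘ₗ Coalgebra.comul

/-- A matched pair `(A, B)` of Hopf algebras: `A` is a left `B`-module coalgebra by `b ▷ a`, `B` is
a right `A`-module coalgebra by `b ◁ a`, and the two actions are compatible with the products and
with each other. -/
structure MatchedPair (k : Type*) [Field k] (A : Type u) (B : Type v) [Ring A] [Ring B]
    [HopfAlgebra k A] [HopfAlgebra k B] where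
  /-- `left (b ⊗ₜ a) = b ▷ a`, a coalgebra map -/
  left : B ⊗[k] A →ₗc[k] A
  /-- `right (b ⊗ₜ a) = b ◁ a`, a coalgebra map -/
  right : B ⊗[k] A →ₗc[k] B
  one_left : ∀ a, left (1 ⊗ₜ a) = a
  mul_left : ∀ b b' a, left ((b * b') ⊗ₜ a) = left (b ⊗ₜ left (b' ⊗ₜ a))
  right_one : ∀ b, right (b ⊗ₜ 1) = b
  right_mul : ∀ b a a', right (b ⊗ₜ (a * a')) = right (right (b ⊗ₜ a) ⊗ₜ a')
  /-- `b ▷ 1 = ε(b) 1` -/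
  left_one : ∀ b, left (b ⊗ₜ 1) = algebraMap k A (Coalgebra.counit b)
  /-- `b ▷ (a a') = ∑ (b₁ ▷ a₁) ((b₂ ◁ a₂) ▷ a')` -/
  left_mul : ∀ b a a', left (b ⊗ₜ (a * a')) =
    LinearMap.mul' k A (LinearMap.lTensor A
      (left.toLinearMap ∘ₗ (TensorProduct.mk k B A).flip a') (crossTwist left right (b ⊗ₜ a)))
  /-- `1 ◁ a = ε(a) 1` -/
  one_right : ∀ a, right (1 ⊗ₜ a) = algebraMap k B (Coalgebra.counit a)
  /-- `(b b') ◁ a = ∑ (b ◁ (b'₁ ▷ a₁)) (b'₂ ◁ a₂)` -/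
  mul_right : ∀ b b' a, right ((b * b') ⊗ₜ a) =
    LinearMap.mul' k B (LinearMap.rTensor B
      (right.toLinearMap ∘ₗ TensorProduct.mk k B A b) (crossTwist left right (b' ⊗ₜ a)))
  /-- `∑ (b₁ ◁ a₁) ⊗ (b₂ ▷ a₂) = ∑ (b₂ ◁ a₂) ⊗ (b₁ ▷ a₁)` -/
  right_left_comm : ∀ b a,
    TensorProduct.map right.toLinearMap left.toLinearMap (Coalgebra.comul (b ⊗ₜ[k] a)) =
      TensorProduct.comm k A B (crossTwist left right (b ⊗ₜ a))

namespace MatchedPair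

variable {k : Type*} [Field k] {A : Type u} {B : Type v} [Ring A] [Ring B]
  [HopfAlgebra k A] [HopfAlgebra k B] (M : MatchedPair k A B)

/-- The action `B ▷ A` is trivial: `b ▷ a = ε(b) a`. -/
def LeftTrivial : Prop :=
  ∀ (b : B) (a : A), M.left (b ⊗ₜ a) = (Coalgebra.counit b : k) • a

/-- The action `B ◁ A` is trivial: `b ◁ a = ε(a) b`. -/
def RightTrivial : Prop :=
  ∀ (b : B) (a : A), M.right (b ⊗ₜ a) = (Coalgebra.counit a : k) • b

/-- `b ⊗ a ↦ ∑ (b₁ ▷ a₁) ⊗ (b₂ ◁ a₂)` -/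
abbrev twist : B ⊗[k] A →ₗ[k] A ⊗[k] B := crossTwist M.left M.right

/-- The product of the double cross product, as a linear map:
`(a ⊗ b) ⊗ (a' ⊗ b') ↦ ∑ a (b₁ ▷ a'₁) ⊗ (b₂ ◁ a'₂) b'`. -/
def mulMap : (A ⊗[k] B) ⊗[k] (A ⊗[k] B) →ₗ[k] A ⊗[k] B :=
  TensorProduct.map (LinearMap.mul' k A) (LinearMap.mul' k B) ∘ₗ
    (TensorProduct.assoc k A A (B ⊗[k] B)).symm.toLinearMap ∘ₗ
    LinearMap.lTensor A (TensorProduct.assoc k A B B).toLinearMap ∘ₗ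
    LinearMap.lTensor A (LinearMap.rTensor B M.twist) ∘ₗ
    LinearMap.lTensor A (TensorProduct.assoc k B A B).symm.toLinearMap ∘ₗ
    (TensorProduct.assoc k A B (A ⊗[k] B)).toLinearMap

theorem mulMap_tmul (a a' : A) (b b' : B) :
    M.mulMap ((a ⊗ₜ b) ⊗ₜ (a' ⊗ₜ b')) =
      TensorProduct.map (LinearMap.mulLeft k a) (LinearMap.mulRight k b')
        (M.twist (b ⊗ₜ a')) := by
  simp only [mulMap, LinearMap.comp_apply, LinearEquiv.coe_coe, TensorProduct.assoc_tmul,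
    LinearMap.lTensor_tmul, TensorProduct.assoc_symm_tmul, LinearMap.rTensor_tmul]
  induction M.twist (b ⊗ₜ a') using TensorProduct.induction_on with
  | zero => simp
  | tmul x y => simp
  | add x y hx hy => simp only [TensorProduct.add_tmul, TensorProduct.tmul_add, map_add, hx, hy]

theorem twist_tmul (b : B) (a : A) : M.twist (b ⊗ₜ a) =
    TensorProduct.map M.left.toLinearMap M.right.toLinearMap
      (Coalgebra.comul (b ⊗ₜ[k] a)) := rfl

theorem twist_one_right (b : B) : M.twist (b ⊗ₜ 1) = 1 ⊗ₜ b := by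
  let r := Coalgebra.Repr.arbitrary k b
  rw [twist_tmul, TensorProduct.comul_tmul, Bialgebra.comul_one, ← r.eq]
  simp only [Algebra.TensorProduct.one_def, TensorProduct.sum_tmul, map_sum,
    TensorProduct.AlgebraTensorModule.tensorTensorTensorComm_tmul, TensorProduct.map_tmul,
    CoalgHom.coe_toLinearMap, CoalgHom.toLinearMap_eq_coe, M.left_one, M.right_one,
    Algebra.algebraMap_eq_smul_one, TensorProduct.smul_tmul]
  rw [← TensorProduct.tmul_sum, Coalgebra.sum_counit_smul]

theorem twist_one_left (a : A) : M.twist (1 ⊗ₜ a) = a ⊗ₜ 1 := by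
  let r := Coalgebra.Repr.arbitrary k a
  rw [twist_tmul, TensorProduct.comul_tmul, Bialgebra.comul_one, ← r.eq]
  simp only [Algebra.TensorProduct.one_def, TensorProduct.tmul_sum, map_sum,
    TensorProduct.AlgebraTensorModule.tensorTensorTensorComm_tmul, TensorProduct.map_tmul,
    CoalgHom.coe_toLinearMap, CoalgHom.toLinearMap_eq_coe, M.one_left, M.one_right,
    Algebra.algebraMap_eq_smul_one, TensorProduct.tmul_smul, TensorProduct.smul_tmul']
  rw [← TensorProduct.sum_tmul]
  congr 1
  have h := congrArg (TensorProduct.rid k A) (Coalgebra.sum_tmul_counit_eq r)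
  simpa only [map_sum, TensorProduct.rid_tmul, one_smul] using h

theorem comul_tmul_mul (b : B) (a a' : A) (r : Coalgebra.Repr k a' (A × A)) :
    Coalgebra.comul (R := k) (b ⊗ₜ[k] (a * a')) = ∑ j ∈ r.index,
      TensorProduct.map (LinearMap.lTensor B (LinearMap.mulRight k (r.left j)))
        (LinearMap.lTensor B (LinearMap.mulRight k (r.right j)))
        (Coalgebra.comul (R := k) (b ⊗ₜ[k] a)) := by
  rw [TensorProduct.comul_tmul, TensorProduct.comul_tmul, Bialgebra.comul_mul, ← r.eq,
    Finset.mul_sum, TensorProduct.tmul_sum, map_sum]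
  refine Finset.sum_congr rfl fun j _ => ?_
  induction Coalgebra.comul (R := k) a using TensorProduct.induction_on with
  | zero => simp
  | add x y hx hy => simp only [TensorProduct.tmul_add, add_mul, map_add, hx, hy]
  | tmul p q =>
    induction Coalgebra.comul (R := k) b using TensorProduct.induction_on with
    | zero => simp
    | add x y hx hy => simp only [TensorProduct.add_tmul, map_add, hx, hy]
    | tmul c d => simp

theorem comul_mul_tmul (b b' : B) (a : A) (r : Coalgebra.Repr k b (B × B)) :
    Coalgebra.comul (R := k) ((b * b') ⊗ₜ[k] a) = ∑ j ∈ r.index,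
      TensorProduct.map (LinearMap.rTensor A (LinearMap.mulLeft k (r.left j)))
        (LinearMap.rTensor A (LinearMap.mulLeft k (r.right j)))
        (Coalgebra.comul (R := k) (b' ⊗ₜ[k] a)) := by
  rw [TensorProduct.comul_tmul, TensorProduct.comul_tmul, Bialgebra.comul_mul, ← r.eq,
    Finset.sum_mul, TensorProduct.sum_tmul, map_sum]
  refine Finset.sum_congr rfl fun j _ => ?_
  induction Coalgebra.comul (R := k) a using TensorProduct.induction_on with
  | zero => simp
  | add x y hx hy => simp only [TensorProduct.tmul_add, map_add, hx, hy]
  | tmul p q =>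
    induction Coalgebra.comul (R := k) b' using TensorProduct.induction_on with
    | zero => simp
    | add x y hx hy => simp only [TensorProduct.add_tmul, mul_add, map_add, hx, hy]
    | tmul c d => simp

theorem twist_eq_sum_right (d : B) (a : A) (r : Coalgebra.Repr k a (A × A)) :
    M.twist (d ⊗ₜ a) = ∑ j ∈ r.index,
      TensorProduct.map (M.left.toLinearMap ∘ₗ (TensorProduct.mk k B A).flip (r.left j))
        (M.right.toLinearMap ∘ₗ (TensorProduct.mk k B A).flip (r.right j))
        (Coalgebra.comul (R := k) d) := by
  rw [twist_tmul, TensorProduct.comul_tmul, ← r.eq, TensorProduct.tmul_sum, map_sum, map_sum]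
  refine Finset.sum_congr rfl fun j _ => ?_
  induction Coalgebra.comul (R := k) d using TensorProduct.induction_on with
  | zero => simp
  | add x y hx hy => simp only [TensorProduct.add_tmul, map_add, hx, hy]
  | tmul c d => simp

theorem twist_eq_sum_left (b : B) (c : A) (r : Coalgebra.Repr k b (B × B)) :
    M.twist (b ⊗ₜ c) = ∑ j ∈ r.index,
      TensorProduct.map (M.left.toLinearMap ∘ₗ TensorProduct.mk k B A (r.left j))
        (M.right.toLinearMap ∘ₗ TensorProduct.mk k B A (r.right j))
        (Coalgebra.comul (R := k) c) := by
  rw [twist_tmul, TensorProduct.comul_tmul, ← r.eq, TensorProduct.sum_tmul, map_sum, map_sum]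
  refine Finset.sum_congr rfl fun j _ => ?_
  induction Coalgebra.comul (R := k) c using TensorProduct.induction_on with
  | zero => simp
  | add x y hx hy => simp only [TensorProduct.tmul_add, map_add, hx, hy]
  | tmul c d => simp

theorem twist_mul_right (b : B) (a a' : A) :
    M.twist (b ⊗ₜ (a * a')) = M.mulMap (M.twist (b ⊗ₜ a) ⊗ₜ (a' ⊗ₜ 1)) := by
  let r := Coalgebra.Repr.arbitrary k a'
  let C := B ⊗[k] A
  let U : A → A ⊗[k] B →ₗ[k] A := fun p => LinearMap.mul' k A ∘ₗ LinearMap.lTensor A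
    (M.left.toLinearMap ∘ₗ (TensorProduct.mk k B A).flip p)
  let V : A → B →ₗ[k] B := fun q => M.right.toLinearMap ∘ₗ (TensorProduct.mk k B A).flip q
  let LR : C ⊗[k] C →ₗ[k] A ⊗[k] B :=
    TensorProduct.map M.left.toLinearMap M.right.toLinearMap
  have hU : ∀ p, M.left.toLinearMap ∘ₗ LinearMap.lTensor B (LinearMap.mulRight k p) =
      (U p ∘ₗ LR) ∘ₗ Coalgebra.comul := fun p =>
    TensorProduct.ext' fun b a => M.left_mul b a p
  have hV : ∀ q, M.right.toLinearMap ∘ₗ LinearMap.lTensor B (LinearMap.mulRight k q) =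
      (V q ∘ₗ M.right.toLinearMap) ∘ₗ LinearMap.id := fun q =>
    TensorProduct.ext' fun b a => M.right_mul b a q
  have hR : ∀ z : C, Coalgebra.comul (R := k) (M.right z) =
      TensorProduct.map M.right.toLinearMap M.right.toLinearMap (Coalgebra.comul z) := fun z =>
    (CoalgHomClass.map_comp_comul_apply M.right z).symm
  have key : ∀ x : C ⊗[k] C, M.mulMap (LR x ⊗ₜ (a' ⊗ₜ 1)) = ∑ j ∈ r.index,
      TensorProduct.map (U (r.left j) ∘ₗ LR) (V (r.right j) ∘ₗ M.right.toLinearMap)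
        ((TensorProduct.assoc k C C C).symm (LinearMap.lTensor C Coalgebra.comul x)) := by
    intro x
    induction x using TensorProduct.induction_on with
    | zero => simp
    | add x y hx hy =>
      simp only [map_add, TensorProduct.add_tmul, hx, hy, Finset.sum_add_distrib]
    | tmul y z =>
      have h1 : LR (y ⊗ₜ z) = M.left y ⊗ₜ M.right z := rfl
      rw [h1, mulMap_tmul, twist_eq_sum_right M _ _ r, map_sum, hR, LinearMap.lTensor_tmul]
      refine Finset.sum_congr rfl fun j _ => ?_
      induction Coalgebra.comul (R := k) z using TensorProduct.induction_on with
      | zero => simp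
      | add x y hx hy => simp only [TensorProduct.tmul_add, map_add, hx, hy]
      | tmul c d => simp [U, V, LR]
  have h2 : M.twist (b ⊗ₜ a) = LR (Coalgebra.comul (b ⊗ₜ[k] a)) := rfl
  rw [h2, key, twist_tmul, comul_tmul_mul b a a' r, map_sum]
  refine Finset.sum_congr rfl fun j _ => ?_
  rw [← LinearMap.comp_apply, ← TensorProduct.map_comp, hU, hV, TensorProduct.map_comp,
    LinearMap.comp_apply]
  congr 1
  exact (Coalgebra.coassoc_symm_apply (R := k) (b ⊗ₜ[k] a)).symm

theorem twist_mul_left (b b' : B) (a : A) :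
    M.twist ((b * b') ⊗ₜ a) = M.mulMap ((1 ⊗ₜ b) ⊗ₜ M.twist (b' ⊗ₜ a)) := by
  let r := Coalgebra.Repr.arbitrary k b
  let C := B ⊗[k] A
  let U : B → A ⊗[k] B →ₗ[k] B := fun p => LinearMap.mul' k B ∘ₗ LinearMap.rTensor B
    (M.right.toLinearMap ∘ₗ TensorProduct.mk k B A p)
  let V : B → A →ₗ[k] A := fun q => M.left.toLinearMap ∘ₗ TensorProduct.mk k B A q
  let LR : C ⊗[k] C →ₗ[k] A ⊗[k] B :=
    TensorProduct.map M.left.toLinearMap M.right.toLinearMap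
  have hU : ∀ p, M.right.toLinearMap ∘ₗ LinearMap.rTensor A (LinearMap.mulLeft k p) =
      (U p ∘ₗ LR) ∘ₗ Coalgebra.comul := fun p =>
    TensorProduct.ext' fun b a => M.mul_right p b a
  have hV : ∀ q, M.left.toLinearMap ∘ₗ LinearMap.rTensor A (LinearMap.mulLeft k q) =
      (V q ∘ₗ M.left.toLinearMap) ∘ₗ LinearMap.id := fun q =>
    TensorProduct.ext' fun b a => M.mul_left q b a
  have hL : ∀ z : C, Coalgebra.comul (R := k) (M.left z) =
      TensorProduct.map M.left.toLinearMap M.left.toLinearMap (Coalgebra.comul z) := fun z =>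
    (CoalgHomClass.map_comp_comul_apply M.left z).symm
  have key : ∀ x : C ⊗[k] C, M.mulMap ((1 ⊗ₜ b) ⊗ₜ LR x) = ∑ j ∈ r.index,
      TensorProduct.map (V (r.left j) ∘ₗ M.left.toLinearMap) (U (r.right j) ∘ₗ LR)
        (TensorProduct.assoc k C C C (LinearMap.rTensor C Coalgebra.comul x)) := by
    intro x
    induction x using TensorProduct.induction_on with
    | zero => simp
    | add x y hx hy =>
      simp only [map_add, TensorProduct.tmul_add, hx, hy, Finset.sum_add_distrib]
    | tmul y z =>
      have h1 : LR (y ⊗ₜ z) = M.left y ⊗ₜ M.right z := rfl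
      rw [h1, mulMap_tmul, twist_eq_sum_left M _ _ r, map_sum, hL, LinearMap.rTensor_tmul]
      refine Finset.sum_congr rfl fun j _ => ?_
      induction Coalgebra.comul (R := k) y using TensorProduct.induction_on with
      | zero => simp
      | add x y hx hy => simp only [TensorProduct.add_tmul, map_add, hx, hy]
      | tmul c d => simp [U, V, LR]
  have h2 : M.twist (b' ⊗ₜ a) = LR (Coalgebra.comul (b' ⊗ₜ[k] a)) := rfl
  rw [h2, key, twist_tmul, comul_mul_tmul b b' a r, map_sum]
  refine Finset.sum_congr rfl fun j _ => ?_
  rw [← LinearMap.comp_apply, ← TensorProduct.map_comp, hU, hV, TensorProduct.map_comp,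
    LinearMap.comp_apply]
  congr 1
  exact (Coalgebra.coassoc_apply (R := k) (b' ⊗ₜ[k] a)).symm

theorem mulMap_map_left (p : A) (x y : A ⊗[k] B) :
    M.mulMap (TensorProduct.map (LinearMap.mulLeft k p) LinearMap.id x ⊗ₜ y) =
      TensorProduct.map (LinearMap.mulLeft k p) LinearMap.id (M.mulMap (x ⊗ₜ y)) := by
  induction x using TensorProduct.induction_on with
  | zero => simp
  | add x x' hx hx' => simp only [map_add, TensorProduct.add_tmul, hx, hx']
  | tmul c d =>
    induction y using TensorProduct.induction_on with
    | zero => simp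
    | add y y' hy hy' => simp only [map_add, TensorProduct.tmul_add, hy, hy']
    | tmul e f =>
      rw [TensorProduct.map_tmul, mulMap_tmul, mulMap_tmul, LinearMap.id_apply]
      generalize M.twist (d ⊗ₜ e) = z
      induction z using TensorProduct.induction_on with
      | zero => simp
      | add z z' hz hz' => simp only [map_add, hz, hz']
      | tmul g h => simp

theorem mulMap_map_right (q : B) (x y : A ⊗[k] B) :
    M.mulMap (x ⊗ₜ TensorProduct.map LinearMap.id (LinearMap.mulRight k q) y) =
      TensorProduct.map LinearMap.id (LinearMap.mulRight k q) (M.mulMap (x ⊗ₜ y)) := by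
  induction x using TensorProduct.induction_on with
  | zero => simp
  | add x x' hx hx' => simp only [map_add, TensorProduct.add_tmul, hx, hx']
  | tmul c d =>
    induction y using TensorProduct.induction_on with
    | zero => simp
    | add y y' hy hy' => simp only [map_add, TensorProduct.tmul_add, hy, hy']
    | tmul e f =>
      rw [TensorProduct.map_tmul, mulMap_tmul, mulMap_tmul, LinearMap.id_apply]
      generalize M.twist (d ⊗ₜ e) = z
      induction z using TensorProduct.induction_on with
      | zero => simp
      | add z z' hz hz' => simp only [map_add, hz, hz']
      | tmul g h => simp [mul_assoc]

theorem twist_eq_mulMap (b : B) (a : A) :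
    M.mulMap ((1 ⊗ₜ b) ⊗ₜ (a ⊗ₜ 1)) = M.twist (b ⊗ₜ a) := by
  rw [mulMap_tmul]
  simp

theorem mulMap_one_tmul (b d : B) (c : A) : M.mulMap ((1 ⊗ₜ b) ⊗ₜ (c ⊗ₜ d)) =
    TensorProduct.map LinearMap.id (LinearMap.mulRight k d) (M.twist (b ⊗ₜ c)) := by
  rw [mulMap_tmul, LinearMap.mulLeft_one]

theorem mulMap_tmul_one (b : B) (c a : A) : M.mulMap ((c ⊗ₜ b) ⊗ₜ (a ⊗ₜ 1)) =
    TensorProduct.map (LinearMap.mulLeft k c) LinearMap.id (M.twist (b ⊗ₜ a)) := by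
  rw [mulMap_tmul, LinearMap.mulRight_one]

theorem tmul_eq_map_left (a : A) (b : B) : a ⊗ₜ[k] b =
    TensorProduct.map (LinearMap.mulLeft k a) LinearMap.id (1 ⊗ₜ[k] b) := by simp

theorem tmul_eq_map_right (a : A) (b : B) : a ⊗ₜ[k] b =
    TensorProduct.map LinearMap.id (LinearMap.mulRight k b) (a ⊗ₜ[k] 1) := by simp

theorem mulMap_assoc_aux (b : B) (y : A ⊗[k] B) (a' : A) :
    M.mulMap (M.mulMap ((1 ⊗ₜ b) ⊗ₜ y) ⊗ₜ (a' ⊗ₜ 1)) =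
      M.mulMap ((1 ⊗ₜ b) ⊗ₜ M.mulMap (y ⊗ₜ (a' ⊗ₜ 1))) := by
  induction y using TensorProduct.induction_on with
  | zero => simp
  | add y y' hy hy' => simp only [map_add, TensorProduct.tmul_add, TensorProduct.add_tmul, hy, hy']
  | tmul c d =>
    trans M.mulMap (M.twist (b ⊗ₜ c) ⊗ₜ M.twist (d ⊗ₜ a'))
    · rw [mulMap_one_tmul]
      generalize M.twist (b ⊗ₜ c) = Y
      induction Y using TensorProduct.induction_on with
      | zero => simp
      | add y y' hy hy' => simp only [map_add, TensorProduct.add_tmul, hy, hy']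
      | tmul e f =>
        rw [TensorProduct.map_tmul, LinearMap.id_apply, LinearMap.mulRight_apply, mulMap_tmul_one,
          twist_mul_left, tmul_eq_map_left e f, mulMap_map_left]
    · rw [mulMap_tmul_one]
      generalize M.twist (d ⊗ₜ a') = Z
      induction Z using TensorProduct.induction_on with
      | zero => simp
      | add y y' hy hy' => simp only [map_add, TensorProduct.tmul_add, hy, hy']
      | tmul g h =>
        rw [TensorProduct.map_tmul, LinearMap.id_apply, LinearMap.mulLeft_apply, mulMap_one_tmul,
          twist_mul_right, tmul_eq_map_right g h, mulMap_map_right]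

theorem mulMap_assoc (x y z : A ⊗[k] B) :
    M.mulMap (M.mulMap (x ⊗ₜ y) ⊗ₜ z) = M.mulMap (x ⊗ₜ M.mulMap (y ⊗ₜ z)) := by
  induction x using TensorProduct.induction_on with
  | zero => simp
  | add x x' hx hx' => simp only [map_add, TensorProduct.add_tmul, hx, hx']
  | tmul a b =>
    induction z using TensorProduct.induction_on with
    | zero => simp
    | add z z' hz hz' => simp only [map_add, TensorProduct.tmul_add, hz, hz']
    | tmul a' b' =>
      rw [tmul_eq_map_left a b, tmul_eq_map_right a' b', mulMap_map_left, mulMap_map_left,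
        mulMap_map_right, mulMap_map_left, mulMap_map_right, mulMap_map_right, mulMap_assoc_aux]

theorem one_mulMap (x : A ⊗[k] B) : M.mulMap ((1 ⊗ₜ 1) ⊗ₜ x) = x := by
  induction x using TensorProduct.induction_on with
  | zero => simp
  | add x x' hx hx' => simp only [map_add, TensorProduct.tmul_add, hx, hx']
  | tmul a b => rw [mulMap_one_tmul, twist_one_left]; simp

theorem mulMap_one (x : A ⊗[k] B) : M.mulMap (x ⊗ₜ (1 ⊗ₜ 1)) = x := by
  induction x using TensorProduct.induction_on with
  | zero => simp
  | add x x' hx hx' => simp only [map_add, TensorProduct.add_tmul, hx, hx']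
  | tmul a b => rw [mulMap_tmul_one, twist_one_right]; simp

/-- The underlying space `A ⊗ B` of the double cross product `A ⋈ B`. -/
def DoubleCross (_M : MatchedPair k A B) : Type (max u v) := A ⊗[k] B

instance : AddCommGroup M.DoubleCross := inferInstanceAs (AddCommGroup (A ⊗[k] B))

instance : Module k M.DoubleCross := inferInstanceAs (Module k (A ⊗[k] B))

/-- The element `a ⋈ b` of the double cross product. -/
def pair (a : A) (b : B) : M.DoubleCross := a ⊗ₜ[k] b

/-- The ring `A ⋈ B` with `(a ⋈ b) (a' ⋈ b') = ∑ a (b₁ ▷ a'₁) ⋈ (b₂ ◁ a'₂) b'` and unit `1 ⋈ 1`. -/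
instance : Ring M.DoubleCross where
  __ := (inferInstance : AddCommGroup M.DoubleCross)
  mul x y := M.mulMap (TensorProduct.tmul k (M := A ⊗[k] B) (N := A ⊗[k] B) x y)
  one := M.pair 1 1
  left_distrib x y z := (congrArg M.mulMap
    (TensorProduct.tmul_add (M := A ⊗[k] B) (N := A ⊗[k] B) x y z)).trans (map_add M.mulMap _ _)
  right_distrib x y z := (congrArg M.mulMap
    (TensorProduct.add_tmul (M := A ⊗[k] B) (N := A ⊗[k] B) x y z)).trans (map_add M.mulMap _ _)
  zero_mul x := (congrArg M.mulMap
    (TensorProduct.zero_tmul (M := A ⊗[k] B) (N := A ⊗[k] B) x)).trans (map_zero M.mulMap)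
  mul_zero x := (congrArg M.mulMap
    (TensorProduct.tmul_zero (M := A ⊗[k] B) (A ⊗[k] B) x)).trans (map_zero M.mulMap)
  mul_assoc := M.mulMap_assoc
  one_mul := M.one_mulMap
  mul_one := M.mulMap_one

theorem pair_mul_pair (a a' : A) (b b' : B) : M.pair a b * M.pair a' b' =
    TensorProduct.map (LinearMap.mulLeft k a) (LinearMap.mulRight k b')
      (M.twist (b ⊗ₜ a')) := M.mulMap_tmul a a' b b'

instance : Algebra k M.DoubleCross := Algebra.ofModule
  (fun c x y => (congrArg M.mulMap (TensorProduct.smul_tmul' (M := A ⊗[k] B) (N := A ⊗[k] B)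
    c x y)).symm.trans (map_smul M.mulMap c _))
  (fun c x y => (congrArg M.mulMap (TensorProduct.tmul_smul (M := A ⊗[k] B) (N := A ⊗[k] B)
    c x y)).trans (map_smul M.mulMap c _))

/-- The inclusion `a ↦ a ⋈ 1` of `A` into `A ⋈ B`. -/
def inl : A →ₐ[k] M.DoubleCross := AlgHom.ofLinearMap
  { toFun := fun a => M.pair a 1
    map_add' := fun a a' => TensorProduct.add_tmul (R := k) a a' (1 : B)
    map_smul' := fun c a => (TensorProduct.smul_tmul' (R := k) c a (1 : B)).symm }
  rfl
  (fun a a' => by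
    change M.pair (a * a') 1 = M.pair a 1 * M.pair a' 1
    rw [pair_mul_pair, twist_one_left]
    simp [pair]
    rfl)

/-- The inclusion `b ↦ 1 ⋈ b` of `B` into `A ⋈ B`. -/
def inr : B →ₐ[k] M.DoubleCross := AlgHom.ofLinearMap
  { toFun := fun b => M.pair 1 b
    map_add' := fun b b' => TensorProduct.tmul_add (R := k) (1 : A) b b'
    map_smul' := fun c b => TensorProduct.tmul_smul (R := k) c (1 : A) b }
  rfl
  (fun b b' => by
    change M.pair 1 (b * b') = M.pair 1 b * M.pair 1 b'
    rw [pair_mul_pair, twist_one_right]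
    simp [pair]
    rfl)

end MatchedPair

end

/-!
For a homomorphism `ι : A → H` of bialgebras with `H` a finite-dimensional Hopf algebra, the depth
of the extension is at most two if and only if `HA⁺ ⊆ A⁺H`, where `A⁺` is the augmentation ideal of
`A` (`HopfExtension.minDepth_le_two_iff_rightAug_le`), and this is equivalent to `A⁺H ⊆ HA⁺`.

The two inclusions are equivalent because `H/A⁺H` and `H/HA⁺` have the same dimension. The Galois
maps `x ⊗ y ↦ ∑ x y₁ ⊗ y₂` and `x ⊗ y ↦ ∑ x₁ ⊗ x₂ y` induce isomorphisms from `H ⊗_A H` to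
`H ⊗ H/A⁺H` and to `H/HA⁺ ⊗ H`. Only the antipode axioms enter, not the bijectivity of the antipode.

*Small depth implies normality.* Suppose that `H ⊗_A H` is a direct summand of some `Hⁿ` as an
`H`-`A`-bimodule. Every linear map out of `H` that is invariant from the left is a multiple of the
counit, so it is invariant from the right; this property passes to `Hⁿ` and to direct summands
(`RSBimodule.LeftInvariantsAreRight`). For the map `x ⊗ y ↦ ε(x) [y]` from `H ⊗_A H` to `H/A⁺H` it
says that `A` acts trivially on `H/A⁺H`, that is, `HA⁺ ⊆ A⁺H`. The mirror image of the argument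
treats `A`-`H`-bimodules, and the projection `H → H/A⁺H` treats depth one.

*Normality implies small depth.* If `HA⁺ ⊆ A⁺H`, then the isomorphism from `H ⊗_A H` to
`H ⊗ H/A⁺H` is one of `H`-`A`-bimodules for the trivial right action of `A` on `H/A⁺H`, and its
target is a direct sum of copies of `H`.

The double cross product `H = A ⋈ B` is a Hopf algebra with the tensor product coalgebra structure
and the antipode `a ⋈ b ↦ S(b) S(a)`. For `A ⊆ H`, the map `ε ⊗ id` identifies `H/A⁺H` with `B`, on
which `A` acts from the right by `◁`; for `B ⊆ H`, the map `id ⊗ ε` identifies `H/HB⁺` with `A`, on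
which `B` acts from the left by `▷`. So normality of `A` and of `B` is triviality of these actions.
-/

noncomputable section

universe u v w

/-! ### Invariant maps out of a bimodule -/

namespace RSBimodule

variable {k : Type*} [CommRing k] {R S : Type*} [Ring R] [Ring S] [Algebra k R] [Algebra k S]

/-- For augmentations `α` of `R` and `β` of `S`: every linear map `f` from the bimodule to `V` that
is left invariant, `f (r m) = α(r) f(m)`, is right invariant, `f (m s) = β(s) f(m)`. -/
def LeftInvariantsAreRight (α : R →ₗ[k] k) (β : S →ₗ[k] k) (V : Type*) [AddCommGroup V]
    [Module k V] (M : RSBimodule.{w} k R S) : Prop :=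
  ∀ f : M.carrier →ₗ[k] V, (∀ r m, f (M.lact r m) = α r • f m) →
    ∀ s m, f (M.ract (MulOpposite.op s) m) = β s • f m

/-- For augmentations `α` of `R` and `β` of `S`: every linear map `f` from the bimodule to `V` that
is right invariant, `f (m s) = β(s) f(m)`, is left invariant, `f (r m) = α(r) f(m)`. -/
def RightInvariantsAreLeft (α : R →ₗ[k] k) (β : S →ₗ[k] k) (V : Type*) [AddCommGroup V]
    [Module k V] (M : RSBimodule.{w} k R S) : Prop :=
  ∀ f : M.carrier →ₗ[k] V, (∀ s m, f (M.ract (MulOpposite.op s) m) = β s • f m) →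
    ∀ r m, f (M.lact r m) = α r • f m

variable {α : R →ₗ[k] k} {β : S →ₗ[k] k} {V : Type*} [AddCommGroup V] [Module k V]

/-- The inclusion of the `j`-th summand into a direct sum of copies. -/
def copiesSingle (p : ℕ) (N : RSBimodule.{w} k R S) (j : Fin p) :
    N.carrier →ₗ[k] (copies p N).carrier :=
  LinearMap.single k (fun _ => N.carrier) j

theorem copies_lact_single (p : ℕ) (N : RSBimodule.{w} k R S) (r : R) (j : Fin p)
    (m : N.carrier) :
    (copies p N).lact r (copiesSingle p N j m) = copiesSingle p N j (N.lact r m) := by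
  funext i
  exact Pi.apply_single (fun _ => N.lact r) (fun _ => map_zero _) j m i

theorem copies_ract_single (p : ℕ) (N : RSBimodule.{w} k R S) (s : Sᵐᵒᵖ) (j : Fin p)
    (m : N.carrier) :
    (copies p N).ract s (copiesSingle p N j m) = copiesSingle p N j (N.ract s m) := by
  funext i
  exact Pi.apply_single (fun _ => N.ract s) (fun _ => map_zero _) j m i

theorem map_copies_eq_sum {p : ℕ} {N : RSBimodule.{w} k R S}
    (f : (copies p N).carrier →ₗ[k] V) (m : (copies p N).carrier) :
    f m = ∑ j, f (copiesSingle p N j (m j)) := by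
  refine (congrArg f (Finset.univ_sum_single (M := fun _ => N.carrier) m).symm).trans ?_
  exact map_sum f _ _

theorem LeftInvariantsAreRight.copies {N : RSBimodule.{w} k R S}
    (h : LeftInvariantsAreRight α β V N) (p : ℕ) :
    LeftInvariantsAreRight α β V (copies p N) := by
  intro f hf s m
  refine (map_copies_eq_sum f _).trans ?_
  rw [map_copies_eq_sum f m, Finset.smul_sum]
  refine Finset.sum_congr rfl fun j _ => ?_
  refine h (f ∘ₗ copiesSingle p N j) (fun r n => ?_) s (m j)
  rw [LinearMap.comp_apply, ← copies_lact_single, hf]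
  rfl

theorem RightInvariantsAreLeft.copies {N : RSBimodule.{w} k R S}
    (h : RightInvariantsAreLeft α β V N) (p : ℕ) :
    RightInvariantsAreLeft α β V (copies p N) := by
  intro f hf r m
  refine (map_copies_eq_sum f _).trans ?_
  rw [map_copies_eq_sum f m, Finset.smul_sum]
  refine Finset.sum_congr rfl fun j _ => ?_
  refine h (f ∘ₗ copiesSingle p N j) (fun s n => ?_) r (m j)
  rw [LinearMap.comp_apply, ← copies_ract_single, hf]
  rfl

theorem LeftInvariantsAreRight.of_isSummand {M : RSBimodule.{v} k R S} {N : RSBimodule.{w} k R S}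
    (h : LeftInvariantsAreRight α β V N) (hMN : IsSummand M N) :
    LeftInvariantsAreRight α β V M := by
  obtain ⟨i, π, hi, hπ, hπi⟩ := hMN
  intro f hf s m
  have := h (f ∘ₗ π) (fun r n => by simp [hπ.1, hf]) s (i m)
  simpa [← hi.2, hπi] using this

theorem RightInvariantsAreLeft.of_isSummand {M : RSBimodule.{v} k R S} {N : RSBimodule.{w} k R S}
    (h : RightInvariantsAreLeft α β V N) (hMN : IsSummand M N) :
    RightInvariantsAreLeft α β V M := by
  obtain ⟨i, π, hi, hπ, hπi⟩ := hMN
  intro f hf r m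
  have := h (f ∘ₗ π) (fun s n => by simp [hπ.2, hf]) r (i m)
  simpa [← hi.1, hπi] using this

theorem LeftInvariantsAreRight.of_similar {M : RSBimodule.{v} k R S} {N : RSBimodule.{w} k R S}
    (h : LeftInvariantsAreRight α β V N) (hMN : Similar M N) :
    LeftInvariantsAreRight α β V M := by
  obtain ⟨⟨p, -, hp⟩, -⟩ := hMN
  exact (h.copies p).of_isSummand hp

theorem RightInvariantsAreLeft.of_similar {M : RSBimodule.{v} k R S} {N : RSBimodule.{w} k R S}
    (h : RightInvariantsAreLeft α β V N) (hMN : Similar M N) :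
    RightInvariantsAreLeft α β V M := by
  obtain ⟨⟨p, -, hp⟩, -⟩ := hMN
  exact (h.copies p).of_isSummand hp

end RSBimodule

/-! ### The minimum depth being at most two -/

namespace RingExtension

theorem minDepth_le_two_iff {k : Type*} [CommRing k] {B : Type u} {A : Type v} [Ring B] [Ring A]
    [Algebra k B] [Algebra k A] (ι : B →ₐ[k] A) :
    minDepth ι ≤ 2 ↔ OddDepth ι 0 ∨ EvenDepth ι 0 := by
  constructor
  · intro h
    unfold minDepth at h
    set s := {d : ℕ∞ | (∃ n : ℕ, d = (2 * n + 1 : ℕ) ∧ OddDepth ι n) ∨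
      (∃ n : ℕ, d = (2 * (n + 1) : ℕ) ∧ EvenDepth ι n)} with hs
    have hne : s.Nonempty := by
      by_contra hne
      rw [Set.not_nonempty_iff_eq_empty.1 hne, sInf_empty] at h
      exact absurd h (by decide)
    rcases csInf_mem hne with ⟨n, hn, hd⟩ | ⟨n, hn, hd⟩
    · rw [hn] at h
      have : 2 * n + 1 ≤ 2 := by exact_mod_cast h
      obtain rfl : n = 0 := by omega
      exact Or.inl hd
    · rw [hn] at h
      have : 2 * (n + 1) ≤ 2 := by exact_mod_cast h
      obtain rfl : n = 0 := by omega
      exact Or.inr hd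
  · rintro (h | h)
    · have : minDepth ι ≤ ((2 * 0 + 1 : ℕ) : ℕ∞) := sInf_le (Or.inl ⟨0, rfl, h⟩)
      exact this.trans (by norm_num)
    · have : minDepth ι ≤ ((2 * (0 + 1) : ℕ) : ℕ∞) := sInf_le (Or.inr ⟨0, rfl, h⟩)
      exact this.trans (by norm_num)

end RingExtension

/-! ### Augmentation submodules and Galois maps of an extension of Hopf algebras -/

namespace HopfExtension

open Coalgebra HopfAlgebra RSBimodule RingExtension

section CommRing

variable {k : Type*} [CommRing k] {A : Type u} {H : Type v} [Ring A] [Ring H] [Bialgebra k A]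
  [HopfAlgebra k H] (ι : A →ₐc[k] H)

/-- The submodule `A⁺H` of `H`, spanned by the elements `ι(a) h - ε(a) h`. -/
def leftAug : Submodule k H :=
  Submodule.span k {x | ∃ (a : A) (h : H), x = ι a * h - counit (R := k) a • h}

/-- The submodule `HA⁺` of `H`, spanned by the elements `h ι(a) - ε(a) h`. -/
def rightAug : Submodule k H :=
  Submodule.span k {x | ∃ (a : A) (h : H), x = h * ι a - counit (R := k) a • h}

/-- The relations that define `H ⊗_A H`, as a submodule of `H ⊗ H`. -/
def rel : Submodule k (H ⊗[k] H) :=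
  Submodule.span k {x | ∃ (x' : H) (a : A) (y : H), x = (x' * ι a) ⊗ₜ[k] y - x' ⊗ₜ[k] (ι a * y)}

theorem mkQ_leftAug (a : A) (h : H) :
    (leftAug ι).mkQ (ι a * h) = counit (R := k) a • (leftAug ι).mkQ h := by
  rw [← map_smul, ← sub_eq_zero, ← map_sub]
  exact (Submodule.Quotient.mk_eq_zero _).2 (Submodule.subset_span ⟨a, h, rfl⟩)

theorem mkQ_rightAug (a : A) (h : H) :
    (rightAug ι).mkQ (h * ι a) = counit (R := k) a • (rightAug ι).mkQ h := by
  rw [← map_smul, ← sub_eq_zero, ← map_sub]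
  exact (Submodule.Quotient.mk_eq_zero _).2 (Submodule.subset_span ⟨a, h, rfl⟩)

theorem mkQ_rel (x : H) (a : A) (y : H) :
    (rel ι).mkQ ((x * ι a) ⊗ₜ y) = (rel ι).mkQ (x ⊗ₜ (ι a * y)) := by
  rw [← sub_eq_zero, ← map_sub]
  exact (Submodule.Quotient.mk_eq_zero _).2 (Submodule.subset_span ⟨x, a, y, rfl⟩)

theorem comul_map (a : A) : comul (R := k) (ι a) = TensorProduct.map (ι : A →ₗ[k] H)
    (ι : A →ₗ[k] H) (comul a) := (CoalgHomClass.map_comp_comul_apply ι a).symm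

theorem leftAug_le_iff {V : Type*} [AddCommGroup V] [Module k V] (f : H →ₗ[k] V) :
    leftAug ι ≤ LinearMap.ker f ↔ ∀ (a : A) (h : H), f (ι a * h) = counit (R := k) a • f h := by
  rw [leftAug, Submodule.span_le]
  constructor
  · intro hf a h
    have := hf ⟨a, h, rfl⟩
    simpa [sub_eq_zero] using this
  · rintro hf _ ⟨a, h, rfl⟩
    simp [hf]

theorem rightAug_le_iff {V : Type*} [AddCommGroup V] [Module k V] (f : H →ₗ[k] V) :
    rightAug ι ≤ LinearMap.ker f ↔ ∀ (a : A) (h : H), f (h * ι a) = counit (R := k) a • f h := by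
  rw [rightAug, Submodule.span_le]
  constructor
  · intro hf a h
    have := hf ⟨a, h, rfl⟩
    simpa [sub_eq_zero] using this
  · rintro hf _ ⟨a, h, rfl⟩
    simp [hf]

variable (k H) in
/-- The Galois map `x ⊗ y ↦ ∑ x y₁ ⊗ y₂` -/
def galoisLeft : H ⊗[k] H →ₗ[k] H ⊗[k] H :=
  TensorProduct.lift (LinearMap.mk₂ k (fun x y : H => (x ⊗ₜ[k] (1 : H)) * comul (R := k) y)
    (fun x x' y => by rw [TensorProduct.add_tmul, add_mul])
    (fun c x y => by rw [← TensorProduct.smul_tmul', smul_mul_assoc])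
    (fun x y y' => by rw [map_add, mul_add])
    (fun c x y => by rw [map_smul, mul_smul_comm]))

variable (k H) in
/-- The inverse `x ⊗ y ↦ ∑ x S(y₁) ⊗ y₂` of the Galois map `x ⊗ y ↦ ∑ x y₁ ⊗ y₂`. -/
def galoisLeftInv : H ⊗[k] H →ₗ[k] H ⊗[k] H :=
  TensorProduct.lift (LinearMap.mk₂ k
    (fun x y : H => (x ⊗ₜ[k] (1 : H)) * (antipode k).rTensor H (comul (R := k) y))
    (fun x x' y => by rw [TensorProduct.add_tmul, add_mul])
    (fun c x y => by rw [← TensorProduct.smul_tmul', smul_mul_assoc])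
    (fun x y y' => by rw [map_add, map_add, mul_add])
    (fun c x y => by rw [map_smul, map_smul, mul_smul_comm]))

variable (k H) in
/-- The Galois map `x ⊗ y ↦ ∑ x₁ ⊗ x₂ y` -/
def galoisRight : H ⊗[k] H →ₗ[k] H ⊗[k] H :=
  TensorProduct.lift (LinearMap.mk₂ k (fun x y : H => comul (R := k) x * ((1 : H) ⊗ₜ[k] y))
    (fun x x' y => by rw [map_add, add_mul])
    (fun c x y => by rw [map_smul, smul_mul_assoc])
    (fun x y y' => by rw [TensorProduct.tmul_add, mul_add])
    (fun c x y => by rw [TensorProduct.tmul_smul, mul_smul_comm]))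

variable (k H) in
/-- The inverse `x ⊗ y ↦ ∑ x₁ ⊗ S(x₂) y` of the Galois map `x ⊗ y ↦ ∑ x₁ ⊗ x₂ y`. -/
def galoisRightInv : H ⊗[k] H →ₗ[k] H ⊗[k] H :=
  TensorProduct.lift (LinearMap.mk₂ k
    (fun x y : H => (antipode k).lTensor H (comul (R := k) x) * ((1 : H) ⊗ₜ[k] y))
    (fun x x' y => by rw [map_add, map_add, add_mul])
    (fun c x y => by rw [map_smul, map_smul, smul_mul_assoc])
    (fun x y y' => by rw [TensorProduct.tmul_add, mul_add])
    (fun c x y => by rw [TensorProduct.tmul_smul, mul_smul_comm]))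

theorem galoisLeft_tmul (x y : H) : galoisLeft k H (x ⊗ₜ y) = (x ⊗ₜ 1) * comul (R := k) y := rfl

theorem galoisLeftInv_tmul (x y : H) :
    galoisLeftInv k H (x ⊗ₜ y) = (x ⊗ₜ 1) * (antipode k).rTensor H (comul (R := k) y) := rfl

theorem galoisRight_tmul (x y : H) : galoisRight k H (x ⊗ₜ y) = comul (R := k) x * (1 ⊗ₜ y) := rfl

theorem galoisRightInv_tmul (x y : H) :
    galoisRightInv k H (x ⊗ₜ y) = (antipode k).lTensor H (comul (R := k) x) * (1 ⊗ₜ y) := rfl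

theorem galoisLeft_mul_left (x : H) (z : H ⊗[k] H) :
    galoisLeft k H ((x ⊗ₜ 1) * z) = (x ⊗ₜ 1) * galoisLeft k H z := by
  induction z using TensorProduct.induction_on with
  | zero => simp
  | add z z' hz hz' => simp only [mul_add, map_add, hz, hz']
  | tmul p q => simp [galoisLeft_tmul, ← mul_assoc]

theorem galoisLeftInv_mul_left (x : H) (z : H ⊗[k] H) :
    galoisLeftInv k H ((x ⊗ₜ 1) * z) = (x ⊗ₜ 1) * galoisLeftInv k H z := by
  induction z using TensorProduct.induction_on with
  | zero => simp
  | add z z' hz hz' => simp only [mul_add, map_add, hz, hz']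
  | tmul p q => simp [galoisLeftInv_tmul, ← mul_assoc]

theorem galoisRight_mul_right (y : H) (z : H ⊗[k] H) :
    galoisRight k H (z * (1 ⊗ₜ y)) = galoisRight k H z * (1 ⊗ₜ y) := by
  induction z using TensorProduct.induction_on with
  | zero => simp
  | add z z' hz hz' => simp only [add_mul, map_add, hz, hz']
  | tmul p q => simp [galoisRight_tmul, mul_assoc]

theorem galoisRightInv_mul_right (y : H) (z : H ⊗[k] H) :
    galoisRightInv k H (z * (1 ⊗ₜ y)) = galoisRightInv k H z * (1 ⊗ₜ y) := by
  induction z using TensorProduct.induction_on with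
  | zero => simp
  | add z z' hz hz' => simp only [add_mul, map_add, hz, hz']
  | tmul p q => simp [galoisRightInv_tmul, mul_assoc]

theorem galoisLeft_galoisLeftInv (z : H ⊗[k] H) : galoisLeft k H (galoisLeftInv k H z) = z := by
  induction z using TensorProduct.induction_on with
  | zero => simp
  | add z z' hz hz' => simp only [map_add, hz, hz']
  | tmul x y =>
    have key : ∀ w : H ⊗[k] H, galoisLeft k H ((antipode k).rTensor H w) =
        (LinearMap.mul' k H ∘ₗ (antipode k).rTensor H).rTensor H
          ((TensorProduct.assoc k H H H).symm (comul.lTensor H w)) := by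
      intro w
      induction w using TensorProduct.induction_on with
      | zero => simp
      | add z z' hz hz' => simp only [map_add, hz, hz']
      | tmul p q =>
        rw [LinearMap.rTensor_tmul, galoisLeft_tmul, LinearMap.lTensor_tmul]
        induction comul (R := k) q using TensorProduct.induction_on with
        | zero => simp
        | add z z' hz hz' => simp only [map_add, mul_add, TensorProduct.tmul_add, hz, hz']
        | tmul c d => simp
    rw [galoisLeftInv_tmul, galoisLeft_mul_left, key, Coalgebra.coassoc_symm_apply,
      ← LinearMap.comp_apply, ← LinearMap.rTensor_comp, LinearMap.comp_assoc,
      mul_antipode_rTensor_comul, LinearMap.rTensor_comp, LinearMap.comp_apply,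
      Coalgebra.rTensor_counit_comul]
    simp

theorem galoisLeftInv_galois (z : H ⊗[k] H) : galoisLeftInv k H (galoisLeft k H z) = z := by
  induction z using TensorProduct.induction_on with
  | zero => simp
  | add z z' hz hz' => simp only [map_add, hz, hz']
  | tmul x y =>
    have key : ∀ w : H ⊗[k] H, galoisLeftInv k H w =
        (LinearMap.mul' k H ∘ₗ (antipode k).lTensor H).rTensor H
          ((TensorProduct.assoc k H H H).symm (comul.lTensor H w)) := by
      intro w
      induction w using TensorProduct.induction_on with
      | zero => simp
      | add z z' hz hz' => simp only [map_add, hz, hz']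
      | tmul p q =>
        rw [galoisLeftInv_tmul, LinearMap.lTensor_tmul]
        induction comul (R := k) q using TensorProduct.induction_on with
        | zero => simp
        | add z z' hz hz' => simp only [map_add, mul_add, TensorProduct.tmul_add, hz, hz']
        | tmul c d => simp
    rw [galoisLeft_tmul, galoisLeftInv_mul_left, key, Coalgebra.coassoc_symm_apply,
      ← LinearMap.comp_apply, ← LinearMap.rTensor_comp, LinearMap.comp_assoc,
      mul_antipode_lTensor_comul, LinearMap.rTensor_comp, LinearMap.comp_apply,
      Coalgebra.rTensor_counit_comul]
    simp

theorem galoisRight_galoisRightInv (z : H ⊗[k] H) : galoisRight k H (galoisRightInv k H z) = z := by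
  induction z using TensorProduct.induction_on with
  | zero => simp
  | add z z' hz hz' => simp only [map_add, hz, hz']
  | tmul x y =>
    have key : ∀ w : H ⊗[k] H, galoisRight k H ((antipode k).lTensor H w) =
        (LinearMap.mul' k H ∘ₗ (antipode k).lTensor H).lTensor H
          (TensorProduct.assoc k H H H (comul.rTensor H w)) := by
      intro w
      induction w using TensorProduct.induction_on with
      | zero => simp
      | add z z' hz hz' => simp only [map_add, hz, hz']
      | tmul p q =>
        rw [LinearMap.lTensor_tmul, galoisRight_tmul, LinearMap.rTensor_tmul]
        induction comul (R := k) p using TensorProduct.induction_on with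
        | zero => simp
        | add z z' hz hz' => simp only [map_add, add_mul, TensorProduct.add_tmul, hz, hz']
        | tmul c d => simp
    rw [galoisRightInv_tmul, galoisRight_mul_right, key, Coalgebra.coassoc_apply,
      ← LinearMap.comp_apply, ← LinearMap.lTensor_comp, LinearMap.comp_assoc,
      mul_antipode_lTensor_comul, LinearMap.lTensor_comp, LinearMap.comp_apply,
      Coalgebra.lTensor_counit_comul]
    simp

theorem galoisRightInv_galoisRight (z : H ⊗[k] H) : galoisRightInv k H (galoisRight k H z) = z := by
  induction z using TensorProduct.induction_on with
  | zero => simp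
  | add z z' hz hz' => simp only [map_add, hz, hz']
  | tmul x y =>
    have key : ∀ w : H ⊗[k] H, galoisRightInv k H w =
        (LinearMap.mul' k H ∘ₗ (antipode k).rTensor H).lTensor H
          (TensorProduct.assoc k H H H (comul.rTensor H w)) := by
      intro w
      induction w using TensorProduct.induction_on with
      | zero => simp
      | add z z' hz hz' => simp only [map_add, hz, hz']
      | tmul p q =>
        rw [galoisRightInv_tmul, LinearMap.rTensor_tmul]
        induction comul (R := k) p using TensorProduct.induction_on with
        | zero => simp
        | add z z' hz hz' => simp only [map_add, add_mul, TensorProduct.add_tmul, hz, hz']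
        | tmul c d => simp
    rw [galoisRight_tmul, galoisRightInv_mul_right, key, Coalgebra.coassoc_apply,
      ← LinearMap.comp_apply, ← LinearMap.lTensor_comp, LinearMap.comp_assoc,
      mul_antipode_rTensor_comul, LinearMap.lTensor_comp, LinearMap.comp_apply,
      Coalgebra.lTensor_counit_comul]
    simp

/-- Modulo `H ⊗ A⁺H`, left multiplication by `Δ(ι a)` is left multiplication by `ι a ⊗ 1`. -/
theorem lTensor_mkQ_comul_mul (a : A) (z : H ⊗[k] H) :
    (leftAug ι).mkQ.lTensor H (comul (R := k) (ι a) * z) =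
      (leftAug ι).mkQ.lTensor H ((ι a ⊗ₜ 1) * z) := by
  induction z using TensorProduct.induction_on with
  | zero => simp
  | add z z' hz hz' => simp only [mul_add, map_add, hz, hz']
  | tmul p q =>
    have key : ∀ w : A ⊗[k] A, (leftAug ι).mkQ.lTensor H
        (TensorProduct.map (ι : A →ₗ[k] H) (ι : A →ₗ[k] H) w * (p ⊗ₜ q)) =
        (ι (TensorProduct.rid k A (counit.lTensor A w)) * p) ⊗ₜ (leftAug ι).mkQ q := by
      intro w
      induction w using TensorProduct.induction_on with
      | zero => simp
      | add z z' hz hz' => simp only [map_add, add_mul, TensorProduct.add_tmul, hz, hz']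
      | tmul c d =>
        simp only [TensorProduct.map_tmul, Algebra.TensorProduct.tmul_mul_tmul,
          LinearMap.lTensor_tmul, TensorProduct.rid_tmul, map_smul, smul_mul_assoc,
          BialgHom.coe_toLinearMap, mkQ_leftAug, TensorProduct.tmul_smul,
          TensorProduct.smul_tmul']
    rw [comul_map, key, Coalgebra.lTensor_counit_comul]
    simp

/-- The map `x ⊗ y ↦ S(x) ⊗_A y` turns left multiplication by `Δ(ι a)` into multiplication by
`ε(a)`, since `∑ S(a₁) ⊗_A a₂ = ∑ S(a₁) a₂ ⊗_A 1`. -/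
theorem mkQ_rTensor_antipode_comul_mul (a : A) (z : H ⊗[k] H) :
    (rel ι).mkQ ((antipode k).rTensor H (comul (R := k) (ι a) * z)) =
      counit (R := k) a • (rel ι).mkQ ((antipode k).rTensor H z) := by
  induction z using TensorProduct.induction_on with
  | zero => simp
  | add z z' hz hz' => simp only [mul_add, map_add, smul_add, hz, hz']
  | tmul p q =>
    have key : ∀ w : A ⊗[k] A, (rel ι).mkQ ((antipode k).rTensor H
        (TensorProduct.map (ι : A →ₗ[k] H) (ι : A →ₗ[k] H) w * (p ⊗ₜ q))) =
        (rel ι).mkQ ((antipode k p * LinearMap.mul' k H ((antipode k).rTensor H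
          (TensorProduct.map (ι : A →ₗ[k] H) (ι : A →ₗ[k] H) w))) ⊗ₜ q) := by
      intro w
      induction w using TensorProduct.induction_on with
      | zero => simp
      | add z z' hz hz' => simp only [map_add, add_mul, mul_add, TensorProduct.add_tmul, hz, hz']
      | tmul c d =>
        simp only [TensorProduct.map_tmul, Algebra.TensorProduct.tmul_mul_tmul,
          LinearMap.rTensor_tmul, antipode_mul_antidistrib, LinearMap.mul'_apply, ← mul_assoc]
        exact (mkQ_rel ι _ d q).symm
    rw [comul_map, key, ← comul_map, mul_antipode_rTensor_comul_apply, ← map_smul,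
      CoalgHomClass.counit_comp_apply, LinearMap.rTensor_tmul, TensorProduct.smul_tmul',
      Algebra.algebraMap_eq_smul_one, mul_smul_comm, mul_one]

/-- Modulo `HA⁺ ⊗ H`, right multiplication by `Δ(ι a)` is right multiplication by `1 ⊗ ι a`. -/
theorem rTensor_mkQ_mul_comul (a : A) (z : H ⊗[k] H) :
    (rightAug ι).mkQ.rTensor H (z * comul (R := k) (ι a)) =
      (rightAug ι).mkQ.rTensor H (z * (1 ⊗ₜ ι a)) := by
  induction z using TensorProduct.induction_on with
  | zero => simp
  | add z z' hz hz' => simp only [add_mul, map_add, hz, hz']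
  | tmul p q =>
    have key : ∀ w : A ⊗[k] A, (rightAug ι).mkQ.rTensor H
        ((p ⊗ₜ q) * TensorProduct.map (ι : A →ₗ[k] H) (ι : A →ₗ[k] H) w) =
        (rightAug ι).mkQ p ⊗ₜ (q * ι (TensorProduct.lid k A (counit.rTensor A w))) := by
      intro w
      induction w using TensorProduct.induction_on with
      | zero => simp
      | add z z' hz hz' => simp only [map_add, mul_add, TensorProduct.tmul_add, hz, hz']
      | tmul c d =>
        simp only [TensorProduct.map_tmul, Algebra.TensorProduct.tmul_mul_tmul,
          LinearMap.rTensor_tmul, TensorProduct.lid_tmul, map_smul, mul_smul_comm,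
          BialgHom.coe_toLinearMap, mkQ_rightAug, TensorProduct.tmul_smul,
          TensorProduct.smul_tmul']
    rw [comul_map, key, Coalgebra.rTensor_counit_comul]
    simp

/-- The map `x ⊗ y ↦ x ⊗_A S(y)` turns right multiplication by `Δ(ι a)` into multiplication by
`ε(a)`, since `∑ a₁ ⊗_A S(a₂) = ∑ 1 ⊗_A a₁ S(a₂)`. -/
theorem mkQ_lTensor_antipode_mul_comul (a : A) (z : H ⊗[k] H) :
    (rel ι).mkQ ((antipode k).lTensor H (z * comul (R := k) (ι a))) =
      counit (R := k) a • (rel ι).mkQ ((antipode k).lTensor H z) := by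
  induction z using TensorProduct.induction_on with
  | zero => simp
  | add z z' hz hz' => simp only [add_mul, map_add, smul_add, hz, hz']
  | tmul p q =>
    have key : ∀ w : A ⊗[k] A, (rel ι).mkQ ((antipode k).lTensor H
        ((p ⊗ₜ q) * TensorProduct.map (ι : A →ₗ[k] H) (ι : A →ₗ[k] H) w)) =
        (rel ι).mkQ (p ⊗ₜ (LinearMap.mul' k H ((antipode k).lTensor H
          (TensorProduct.map (ι : A →ₗ[k] H) (ι : A →ₗ[k] H) w)) * antipode k q)) := by
      intro w
      induction w using TensorProduct.induction_on with
      | zero => simp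
      | add z z' hz hz' => simp only [map_add, add_mul, mul_add, TensorProduct.tmul_add, hz, hz']
      | tmul c d =>
        simp only [TensorProduct.map_tmul, Algebra.TensorProduct.tmul_mul_tmul,
          LinearMap.lTensor_tmul, antipode_mul_antidistrib, LinearMap.mul'_apply, mul_assoc]
        exact mkQ_rel ι p c _
    rw [comul_map, key, ← comul_map, mul_antipode_lTensor_comul_apply, ← map_smul,
      CoalgHomClass.counit_comp_apply, LinearMap.lTensor_tmul, ← TensorProduct.tmul_smul,
      Algebra.algebraMap_eq_smul_one, smul_mul_assoc, one_mul]

/-! ### The relative tensor square of a Hopf algebra over a subalgebra -/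

theorem rel_le_ker_iff {V : Type*} [AddCommGroup V] [Module k V] (f : H ⊗[k] H →ₗ[k] V) :
    rel ι ≤ LinearMap.ker f ↔
      ∀ (x : H) (a : A) (y : H), f ((x * ι a) ⊗ₜ y) = f (x ⊗ₜ (ι a * y)) := by
  rw [rel, Submodule.span_le]
  constructor
  · intro hf x a y
    have := hf ⟨x, a, y, rfl⟩
    simpa [sub_eq_zero] using this
  · rintro hf _ ⟨x, a, y, rfl⟩
    simp [hf]

/-- Left multiplication by `r` on `H ⊗_A H`, which is by definition the underlying space of
`tensorPower ι 1`. -/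
def relLact (r : H) : Module.End k ((H ⊗[k] H) ⧸ rel ι) :=
  (tensorPower (ι : A →ₐ[k] H) 1).lact r

/-- Right multiplication by `r` on `H ⊗_A H`. -/
def relRact (r : H) : Module.End k ((H ⊗[k] H) ⧸ rel ι) :=
  (tensorPower (ι : A →ₐ[k] H) 1).ract (MulOpposite.op r)

theorem relLact_mkQ (r : H) (z : H ⊗[k] H) :
    relLact ι r ((rel ι).mkQ z) = (rel ι).mkQ ((r ⊗ₜ 1) * z) := by
  induction z using TensorProduct.induction_on with
  | zero => simp
  | add z z' hz hz' => simp only [map_add, hz, hz', mul_add]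
  | tmul x y =>
    rw [Algebra.TensorProduct.tmul_mul_tmul, one_mul]
    rfl

theorem relRact_mkQ (r : H) (z : H ⊗[k] H) :
    relRact ι r ((rel ι).mkQ z) = (rel ι).mkQ (z * (1 ⊗ₜ r)) := by
  induction z using TensorProduct.induction_on with
  | zero => simp
  | add z z' hz hz' => simp only [map_add, hz, hz', add_mul]
  | tmul x y =>
    rw [Algebra.TensorProduct.tmul_mul_tmul, mul_one]
    rfl

/-- The map `H ⊗_A H → H ⊗ H/A⁺H`, `x ⊗ y ↦ ∑ x y₁ ⊗ y₂`. -/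
def toTensorLeft : (H ⊗[k] H) ⧸ rel ι →ₗ[k] H ⊗[k] (H ⧸ leftAug ι) :=
  (rel ι).liftQ ((leftAug ι).mkQ.lTensor H ∘ₗ galoisLeft k H) <| by
    rw [rel_le_ker_iff]
    intro x a y
    have h : (x * ι a) ⊗ₜ[k] (1 : H) = (x ⊗ₜ 1) * (ι a ⊗ₜ 1) := by simp
    have hx : ∀ z : H ⊗[k] H, (leftAug ι).mkQ.lTensor H ((x ⊗ₜ 1) * z) =
        (LinearMap.mulLeft k x).rTensor _ ((leftAug ι).mkQ.lTensor H z) := fun z => by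
      induction z using TensorProduct.induction_on with
      | zero => simp
      | add z z' hz hz' => simp only [mul_add, map_add, hz, hz']
      | tmul p q => simp
    simp only [LinearMap.comp_apply, galoisLeft_tmul, Bialgebra.comul_mul]
    rw [hx, lTensor_mkQ_comul_mul, ← hx, h, mul_assoc]

/-- The map `H ⊗_A H → H/HA⁺ ⊗ H`, `x ⊗ y ↦ ∑ x₁ ⊗ x₂ y`. -/
def toTensorRight : (H ⊗[k] H) ⧸ rel ι →ₗ[k] (H ⧸ rightAug ι) ⊗[k] H :=
  (rel ι).liftQ ((rightAug ι).mkQ.rTensor H ∘ₗ galoisRight k H) <| by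
    rw [rel_le_ker_iff]
    intro x a y
    have h : (1 : H) ⊗ₜ[k] (ι a * y) = (1 ⊗ₜ ι a) * (1 ⊗ₜ y) := by simp
    have hy : ∀ z : H ⊗[k] H, (rightAug ι).mkQ.rTensor H (z * (1 ⊗ₜ y)) =
        (LinearMap.mulRight k y).lTensor _ ((rightAug ι).mkQ.rTensor H z) := fun z => by
      induction z using TensorProduct.induction_on with
      | zero => simp
      | add z z' hz hz' => simp only [add_mul, map_add, hz, hz']
      | tmul p q => simp
    simp only [LinearMap.comp_apply, galoisRight_tmul, Bialgebra.comul_mul]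
    rw [hy, rTensor_mkQ_mul_comul, ← hy, h, mul_assoc]

/-- The map `H ⊗ H/A⁺H → H ⊗_A H`, `x ⊗ y ↦ ∑ x S(y₁) ⊗ y₂`. -/
def ofTensorLeft : H ⊗[k] (H ⧸ leftAug ι) →ₗ[k] (H ⊗[k] H) ⧸ rel ι :=
  TensorProduct.lift <| LinearMap.flip <|
    (leftAug ι).liftQ (TensorProduct.curry ((rel ι).mkQ ∘ₗ galoisLeftInv k H)).flip <| by
      rw [leftAug_le_iff]
      intro a y
      ext x
      simp only [LinearMap.flip_apply, TensorProduct.curry_apply, LinearMap.comp_apply,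
        galoisLeftInv_tmul, Bialgebra.comul_mul, LinearMap.smul_apply]
      rw [← relLact_mkQ, mkQ_rTensor_antipode_comul_mul, map_smul, relLact_mkQ]

/-- The map `H/HA⁺ ⊗ H → H ⊗_A H`, `x ⊗ y ↦ ∑ x₁ ⊗ S(x₂) y`. -/
def ofTensorRight : (H ⧸ rightAug ι) ⊗[k] H →ₗ[k] (H ⊗[k] H) ⧸ rel ι :=
  TensorProduct.lift <|
    (rightAug ι).liftQ (TensorProduct.curry ((rel ι).mkQ ∘ₗ galoisRightInv k H)) <| by
      rw [rightAug_le_iff]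
      intro a x
      ext y
      simp only [TensorProduct.curry_apply, LinearMap.comp_apply,
        galoisRightInv_tmul, Bialgebra.comul_mul, LinearMap.smul_apply]
      rw [← relRact_mkQ, mkQ_lTensor_antipode_mul_comul, map_smul, relRact_mkQ]

theorem toTensorLeft_mkQ (z : H ⊗[k] H) : toTensorLeft ι ((rel ι).mkQ z) =
    (leftAug ι).mkQ.lTensor H (galoisLeft k H z) := rfl

theorem toTensorRight_mkQ (z : H ⊗[k] H) : toTensorRight ι ((rel ι).mkQ z) =
    (rightAug ι).mkQ.rTensor H (galoisRight k H z) := rfl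

theorem ofTensorLeft_mkQ (z : H ⊗[k] H) :
    ofTensorLeft ι ((leftAug ι).mkQ.lTensor H z) = (rel ι).mkQ (galoisLeftInv k H z) := by
  induction z using TensorProduct.induction_on with
  | zero => simp
  | add z z' hz hz' => simp only [map_add, hz, hz']
  | tmul p q => rfl

theorem ofTensorRight_mkQ (z : H ⊗[k] H) :
    ofTensorRight ι ((rightAug ι).mkQ.rTensor H z) = (rel ι).mkQ (galoisRightInv k H z) := by
  induction z using TensorProduct.induction_on with
  | zero => simp
  | add z z' hz hz' => simp only [map_add, hz, hz']
  | tmul p q => rfl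

/-- The isomorphism `H ⊗_A H ≃ H ⊗ H/A⁺H`, `x ⊗ y ↦ ∑ x y₁ ⊗ y₂`. -/
def tensorEquivLeft : ((H ⊗[k] H) ⧸ rel ι) ≃ₗ[k] H ⊗[k] (H ⧸ leftAug ι) where
  __ := toTensorLeft ι
  invFun := ofTensorLeft ι
  left_inv z := by
    obtain ⟨z, rfl⟩ := (rel ι).mkQ_surjective z
    exact (ofTensorLeft_mkQ ι _).trans (congrArg _ (galoisLeftInv_galois z))
  right_inv z := by
    obtain ⟨z, rfl⟩ := LinearMap.lTensor_surjective H (leftAug ι).mkQ_surjective z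
    rw [ofTensorLeft_mkQ]
    exact (toTensorLeft_mkQ ι _).trans (congrArg _ (galoisLeft_galoisLeftInv z))

/-- The isomorphism `H ⊗_A H ≃ H/HA⁺ ⊗ H`, `x ⊗ y ↦ ∑ x₁ ⊗ x₂ y`. -/
def tensorEquivRight : ((H ⊗[k] H) ⧸ rel ι) ≃ₗ[k] (H ⧸ rightAug ι) ⊗[k] H where
  __ := toTensorRight ι
  invFun := ofTensorRight ι
  left_inv z := by
    obtain ⟨z, rfl⟩ := (rel ι).mkQ_surjective z
    exact (ofTensorRight_mkQ ι _).trans (congrArg _ (galoisRightInv_galoisRight z))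
  right_inv z := by
    obtain ⟨z, rfl⟩ := LinearMap.rTensor_surjective H (rightAug ι).mkQ_surjective z
    rw [ofTensorRight_mkQ]
    exact (toTensorRight_mkQ ι _).trans (congrArg _ (galoisRight_galoisRightInv z))

/-! ### Normality of extensions of small depth -/

/-- A left invariant map out of `H` is determined by its value at `1`. -/
theorem leftInvariantsAreRight_regular (V : Type*) [AddCommGroup V] [Module k V] :
    LeftInvariantsAreRight counit counit V
      ((tensorPower (ι : A →ₐ[k] H) 0).restrict (AlgHom.id k H) (ι : A →ₐ[k] H)) := by
  intro f hf a (m : H)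
  have h : ∀ x : H, f x = counit (R := k) x • f (1 : H) := fun x =>
    (congrArg f (mul_one x).symm).trans (hf x (1 : H))
  refine (h (m * ι a)).trans ?_
  rw [h m, Bialgebra.counit_mul, CoalgHomClass.counit_comp_apply, smul_smul, mul_comm]

theorem rightInvariantsAreLeft_regular (V : Type*) [AddCommGroup V] [Module k V] :
    RightInvariantsAreLeft counit counit V
      ((tensorPower (ι : A →ₐ[k] H) 0).restrict (ι : A →ₐ[k] H) (AlgHom.id k H)) := by
  intro f hf a (m : H)
  have h : ∀ x : H, f x = counit (R := k) x • f (1 : H) := fun x =>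
    (congrArg f (one_mul x).symm).trans (hf x (1 : H))
  refine (h (ι a * m)).trans ?_
  rw [h m, Bialgebra.counit_mul, CoalgHomClass.counit_comp_apply, smul_smul]

theorem leftInvariantsAreRight_regular_self (A : Type*) [Ring A] [Bialgebra k A] (V : Type*)
    [AddCommGroup V] [Module k V] :
    LeftInvariantsAreRight counit counit V (RSBimodule.regular k A) := by
  intro f hf a (m : A)
  have h : ∀ x : A, f x = counit (R := k) x • f (1 : A) := fun x =>
    (congrArg f (mul_one x).symm).trans (hf x (1 : A))
  refine (h (m * a)).trans ?_
  rw [h m, Bialgebra.counit_mul, smul_smul, mul_comm]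

/-- If `H` and `A` are similar as `A`-`A`-bimodules, then `A` acts trivially on `H/A⁺H`. -/
theorem rightAug_le_of_oddDepth (h : OddDepth (ι : A →ₐ[k] H) 0) : rightAug ι ≤ leftAug ι := by
  have := (leftInvariantsAreRight_regular_self A (H ⧸ leftAug ι)).of_similar h
    (leftAug ι).mkQ (mkQ_leftAug ι)
  rw [← (leftAug ι).ker_mkQ, rightAug_le_iff]
  exact this

/-- The `H`-`A`-bimodule version of the depth two condition makes `A` act trivially on `H/A⁺H`. -/
theorem rightAug_le_of_similar
    (h : ((tensorPower (ι : A →ₐ[k] H) 1).restrict (AlgHom.id k H) (ι : A →ₐ[k] H)).Similar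
      ((tensorPower (ι : A →ₐ[k] H) 0).restrict (AlgHom.id k H) (ι : A →ₐ[k] H))) :
    rightAug ι ≤ leftAug ι := by
  -- the left invariant map `x ⊗ y ↦ ε(x) [y]`
  let f : (H ⊗[k] H) ⧸ rel ι →ₗ[k] H ⧸ leftAug ι :=
    (rel ι).liftQ ((TensorProduct.lid k _).toLinearMap ∘ₗ
        TensorProduct.map counit (leftAug ι).mkQ) <| by
      rw [rel_le_ker_iff]
      intro x a y
      simp [-Submodule.mkQ_apply, mkQ_leftAug, smul_smul, mul_comm]
  have hf : ∀ (r : H) (m : (H ⊗[k] H) ⧸ rel ι),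
      f (relLact ι r m) = counit (R := k) r • f m := by
    intro r m
    obtain ⟨z, rfl⟩ := (rel ι).mkQ_surjective m
    induction z using TensorProduct.induction_on with
    | zero => simp
    | add z z' hz hz' => simp only [map_add, hz, hz', smul_add]
    | tmul x y =>
      change counit (R := k) (r * x) • (leftAug ι).mkQ y =
        counit (R := k) r • counit (R := k) x • (leftAug ι).mkQ y
      rw [Bialgebra.counit_mul, mul_smul]
  have := (leftInvariantsAreRight_regular ι (H ⧸ leftAug ι)).of_similar h f hf
  rw [← (leftAug ι).ker_mkQ, rightAug_le_iff]
  intro a y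
  have h' : counit (R := k) (1 : H) • (leftAug ι).mkQ (y * ι a) =
      counit (R := k) a • counit (R := k) (1 : H) • (leftAug ι).mkQ y :=
    this a ((rel ι).mkQ (1 ⊗ₜ y))
  simpa using h'

/-- The `A`-`H`-bimodule version of the depth two condition makes `A` act trivially on `H/HA⁺`. -/
theorem leftAug_le_of_similar
    (h : ((tensorPower (ι : A →ₐ[k] H) 1).restrict (ι : A →ₐ[k] H) (AlgHom.id k H)).Similar
      ((tensorPower (ι : A →ₐ[k] H) 0).restrict (ι : A →ₐ[k] H) (AlgHom.id k H))) :
    leftAug ι ≤ rightAug ι := by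
  -- the right invariant map `x ⊗ y ↦ ε(y) [x]`
  let f : (H ⊗[k] H) ⧸ rel ι →ₗ[k] H ⧸ rightAug ι :=
    (rel ι).liftQ ((TensorProduct.rid k _).toLinearMap ∘ₗ
        TensorProduct.map (rightAug ι).mkQ counit) <| by
      rw [rel_le_ker_iff]
      intro x a y
      simp [-Submodule.mkQ_apply, mkQ_rightAug, mul_smul, smul_comm (counit (R := k) a)]
  have hf : ∀ (r : H) (m : (H ⊗[k] H) ⧸ rel ι),
      f (relRact ι r m) = counit (R := k) r • f m := by
    intro r m
    obtain ⟨z, rfl⟩ := (rel ι).mkQ_surjective m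
    induction z using TensorProduct.induction_on with
    | zero => simp
    | add z z' hz hz' => simp only [map_add, hz, hz', smul_add]
    | tmul x y =>
      change counit (R := k) (y * r) • (rightAug ι).mkQ x =
        counit (R := k) r • counit (R := k) y • (rightAug ι).mkQ x
      rw [Bialgebra.counit_mul, mul_comm, mul_smul]
  have := (rightInvariantsAreLeft_regular ι (H ⧸ rightAug ι)).of_similar h f hf
  rw [← (rightAug ι).ker_mkQ, leftAug_le_iff]
  intro a x
  have h' : counit (R := k) (1 : H) • (rightAug ι).mkQ (ι a * x) =
      counit (R := k) a • counit (R := k) (1 : H) • (rightAug ι).mkQ x :=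
    this a ((rel ι).mkQ (x ⊗ₜ 1))
  simpa using h'

end CommRing

/-! ### Hopf algebras over a field: dimensions, and the depth of normal extensions -/

section Field

variable {k : Type*} [Field k] {A : Type u} {H : Type v} [Ring A] [Ring H] [Bialgebra k A]
  [HopfAlgebra k H] (ι : A →ₐc[k] H)

/-- Both `H/A⁺H` and `H/HA⁺` have dimension `dim (H ⊗_A H) / dim H`. -/
theorem finrank_leftAug_eq [FiniteDimensional k H] :
    Module.finrank k (leftAug ι) = Module.finrank k (rightAug ι) := by
  have : Nontrivial H := Bialgebra.nontrivial (R := k)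
  have h := (tensorEquivLeft ι).finrank_eq.symm.trans (tensorEquivRight ι).finrank_eq
  rw [Module.finrank_tensorProduct, Module.finrank_tensorProduct, mul_comm] at h
  have h' := Nat.eq_of_mul_eq_mul_right Module.finrank_pos h
  have h₁ := (leftAug ι).finrank_quotient_add_finrank
  have h₂ := (rightAug ι).finrank_quotient_add_finrank
  omega

theorem rightAug_le_leftAug_iff [FiniteDimensional k H] :
    rightAug ι ≤ leftAug ι ↔ leftAug ι ≤ rightAug ι :=
  ⟨fun h => (Submodule.eq_of_le_of_finrank_eq h (finrank_leftAug_eq ι).symm).ge,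
    fun h => (Submodule.eq_of_le_of_finrank_eq h (finrank_leftAug_eq ι)).ge⟩

theorem galoisLeft_mul_comul (z : H ⊗[k] H) (h : H) :
    galoisLeft k H (z * (1 ⊗ₜ h)) = galoisLeft k H z * comul (R := k) h := by
  induction z using TensorProduct.induction_on with
  | zero => simp
  | add z z' hz hz' => simp only [map_add, hz, hz', add_mul]
  | tmul x y => simp [galoisLeft_tmul, mul_assoc]

/-- If `HA⁺ ⊆ A⁺H`, then `A` acts trivially from the right on `H/A⁺H`, so that on `H ⊗ H/A⁺H` the
diagonal right action of `A` is the action on the first factor. -/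
theorem lTensor_mkQ_mul_comul (h : rightAug ι ≤ leftAug ι) (a : A) (z : H ⊗[k] H) :
    (leftAug ι).mkQ.lTensor H (z * comul (R := k) (ι a)) =
      (leftAug ι).mkQ.lTensor H (z * (ι a ⊗ₜ 1)) := by
  have hr : ∀ (a : A) (h : H),
      (leftAug ι).mkQ (h * ι a) = counit (R := k) a • (leftAug ι).mkQ h := by
    rwa [← rightAug_le_iff, Submodule.ker_mkQ]
  induction z using TensorProduct.induction_on with
  | zero => simp
  | add z z' hz hz' => simp only [add_mul, map_add, hz, hz']
  | tmul p q =>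
    have key : ∀ w : A ⊗[k] A, (leftAug ι).mkQ.lTensor H
        ((p ⊗ₜ q) * TensorProduct.map (ι : A →ₗ[k] H) (ι : A →ₗ[k] H) w) =
        (p * ι (TensorProduct.rid k A (counit.lTensor A w))) ⊗ₜ (leftAug ι).mkQ q := by
      intro w
      induction w using TensorProduct.induction_on with
      | zero => simp
      | add z z' hz hz' => simp only [map_add, mul_add, TensorProduct.add_tmul, hz, hz']
      | tmul c d =>
        simp only [TensorProduct.map_tmul, Algebra.TensorProduct.tmul_mul_tmul,
          LinearMap.lTensor_tmul, TensorProduct.rid_tmul, map_smul, mul_smul_comm,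
          BialgHom.coe_toLinearMap, hr, TensorProduct.tmul_smul, TensorProduct.smul_tmul']
    rw [comul_map, key, Coalgebra.lTensor_counit_comul]
    simp

/-- If `HA⁺ ⊆ A⁺H`, then `H ⊗_A H` is a direct sum of copies of `H` as an `H`-`A`-bimodule, one for
each element of a basis of `H/A⁺H`. -/
theorem evenDepth_of_rightAug_le [FiniteDimensional k H] (h : rightAug ι ≤ leftAug ι) :
    EvenDepth (ι : A →ₐ[k] H) 0 := by
  right
  let b := Module.finBasis k (H ⧸ leftAug ι)
  have hpos : 0 < Module.finrank k (H ⧸ leftAug ι) := by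
    have hne : leftAug ι ≠ ⊤ := fun htop => by
      have hle : leftAug ι ≤ LinearMap.ker (counit (R := k) (A := H)) := by
        rw [leftAug_le_iff]
        intro a y
        simp
      have : counit (R := k) (1 : H) = 0 := hle (htop ▸ Submodule.mem_top)
      simp at this
    have : Nontrivial (H ⧸ leftAug ι) := Submodule.Quotient.nontrivial_iff.2 hne
    exact Module.finrank_pos
  -- the `j`-th coordinate `H ⊗ H/A⁺H → H` in the basis `b`
  let c : Fin (Module.finrank k (H ⧸ leftAug ι)) → H ⊗[k] (H ⧸ leftAug ι) →ₗ[k] H := fun j =>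
    (TensorProduct.rid k H).toLinearMap ∘ₗ (b.coord j).lTensor H
  let d : (Fin (Module.finrank k (H ⧸ leftAug ι)) → H) →ₗ[k] H ⊗[k] (H ⧸ leftAug ι) :=
    ∑ j, (TensorProduct.mk k H (H ⧸ leftAug ι)).flip (b j) ∘ₗ LinearMap.proj j
  have hdc : ∀ z, d (LinearMap.pi c z) = z := by
    intro z
    induction z using TensorProduct.induction_on with
    | zero => simp
    | add z z' hz hz' => simp only [map_add, hz, hz']
    | tmul x q =>
      simp only [d, c, LinearMap.sum_apply, LinearMap.comp_apply, LinearMap.proj_apply,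
        LinearMap.pi_apply, LinearMap.lTensor_tmul, LinearEquiv.coe_coe, TensorProduct.rid_tmul,
        LinearMap.flip_apply, TensorProduct.mk_apply, TensorProduct.smul_tmul]
      rw [← TensorProduct.tmul_sum]
      simp [b.sum_repr]
  have hcd : ∀ v, LinearMap.pi c (d v) = v := by
    intro v
    funext i
    simp [c, d, map_sum, Finsupp.single_apply]
  let e : ((H ⊗[k] H) ⧸ rel ι) ≃ₗ[k] (Fin (Module.finrank k (H ⧸ leftAug ι)) → H) :=
    tensorEquivLeft ι ≪≫ₗ LinearEquiv.ofLinearMap (LinearMap.pi c) d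
      (LinearMap.ext hcd) (LinearMap.ext hdc)
  have hcl : ∀ j x z, c j ((leftAug ι).mkQ.lTensor H ((x ⊗ₜ 1) * z)) =
      x * c j ((leftAug ι).mkQ.lTensor H z) := by
    intro j x z
    induction z using TensorProduct.induction_on with
    | zero => simp
    | add z z' hz hz' => simp only [mul_add, map_add, hz, hz']
    | tmul p q => simp [c]
  have hcr : ∀ j y z, c j ((leftAug ι).mkQ.lTensor H (z * (y ⊗ₜ 1))) =
      c j ((leftAug ι).mkQ.lTensor H z) * y := by
    intro j y z
    induction z using TensorProduct.induction_on with
    | zero => simp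
    | add z z' hz hz' => simp only [add_mul, map_add, hz, hz']
    | tmul p q => simp [c]
  have he : ∀ z j, e ((rel ι).mkQ z) j = c j ((leftAug ι).mkQ.lTensor H (galoisLeft k H z)) :=
    fun z j => rfl
  have hl : ∀ (r : H) (m : (H ⊗[k] H) ⧸ rel ι), e (relLact ι r m) = fun j => r * e m j := by
    intro r m
    funext j
    obtain ⟨z, rfl⟩ := (rel ι).mkQ_surjective m
    rw [he, ← hcl, ← galoisLeft_mul_left, ← he, relLact_mkQ]
  have hr : ∀ (a : A) (m : (H ⊗[k] H) ⧸ rel ι),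
      e (relRact ι (ι a) m) = fun j => e m j * ι a := by
    intro a m
    funext j
    obtain ⟨z, rfl⟩ := (rel ι).mkQ_surjective m
    rw [he, ← hcr, ← lTensor_mkQ_mul_comul ι h, ← galoisLeft_mul_comul, ← he, relRact_mkQ]
  have hl' : ∀ (r : H) (v : Fin (Module.finrank k (H ⧸ leftAug ι)) → H),
      e.symm (fun j => r * v j) = relLact ι r (e.symm v) := by
    intro r v
    rw [LinearEquiv.symm_apply_eq, hl, e.apply_symm_apply]
  have hr' : ∀ (a : A) (v : Fin (Module.finrank k (H ⧸ leftAug ι)) → H),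
      e.symm (fun j => v j * ι a) = relRact ι (ι a) (e.symm v) := by
    intro a v
    rw [LinearEquiv.symm_apply_eq, hr, e.apply_symm_apply]
  refine ⟨⟨_, hpos, e.toLinearMap, e.symm.toLinearMap, ⟨hl, fun s => hr s.unop⟩,
    ⟨hl', fun s => hr' s.unop⟩, e.symm_apply_apply⟩, ⟨1, one_pos, ?_⟩⟩
  -- `h ↦ h ⊗ 1` is split by the multiplication `H ⊗_A H → H`
  let i : H →ₗ[k] (Fin 1 → (H ⊗[k] H) ⧸ rel ι) :=
    LinearMap.pi fun _ => (rel ι).mkQ ∘ₗ (TensorProduct.mk k H H).flip 1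
  let μ : ((H ⊗[k] H) ⧸ rel ι) →ₗ[k] H := (rel ι).liftQ (LinearMap.mul' k H) <| by
    rw [rel_le_ker_iff]
    intro x a y
    simp [mul_assoc]
  have hi : ∀ (a : A) (m : H), (rel ι).mkQ ((m * ι a) ⊗ₜ 1) =
      relRact ι (ι a) ((rel ι).mkQ (m ⊗ₜ 1)) := by
    intro a m
    rw [relRact_mkQ, mkQ_rel]
    simp
  have hμl : ∀ (r : H) (t : (H ⊗[k] H) ⧸ rel ι), μ (relLact ι r t) = r * μ t := by
    intro r t
    obtain ⟨z, rfl⟩ := (rel ι).mkQ_surjective t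
    induction z using TensorProduct.induction_on with
    | zero => simp
    | add z z' hz hz' => simp only [map_add, hz, hz', mul_add]
    | tmul x y => exact mul_assoc r x y
  have hμr : ∀ (r : H) (t : (H ⊗[k] H) ⧸ rel ι), μ (relRact ι r t) = μ t * r := by
    intro r t
    obtain ⟨z, rfl⟩ := (rel ι).mkQ_surjective t
    induction z using TensorProduct.induction_on with
    | zero => simp
    | add z z' hz hz' => simp only [map_add, hz, hz', add_mul]
    | tmul x y => exact (mul_assoc x y r).symm
  exact ⟨i, μ ∘ₗ LinearMap.proj 0, ⟨fun r m => rfl, fun s m => funext fun _ => hi s.unop m⟩,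
    ⟨fun r m => hμl r (m 0), fun s m => hμr (ι s.unop) (m 0)⟩, fun m => mul_one (M := H) m⟩

/-- A finite-dimensional extension of Hopf algebras has depth at most two if and only if it is
normal. -/
theorem minDepth_le_two_iff_rightAug_le [FiniteDimensional k H] :
    minDepth (ι : A →ₐ[k] H) ≤ 2 ↔ rightAug ι ≤ leftAug ι := by
  rw [minDepth_le_two_iff]
  constructor
  · rintro (h | h | h)
    · exact rightAug_le_of_oddDepth ι h
    · exact (rightAug_le_leftAug_iff ι).2 (leftAug_le_of_similar ι h)
    · exact rightAug_le_of_similar ι h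
  · exact fun h => Or.inr (evenDepth_of_rightAug_le ι h)

end Field

end HopfExtension

/-! ### The double cross product as a Hopf algebra -/

open Coalgebra in
/-- If the coalgebra maps `f` and `g` satisfy `∑ g(c₁) ⊗ f(c₂) = ∑ g(c₂) ⊗ f(c₁)`, then
`c ↦ ∑ f(c₁) ⊗ g(c₂)` respects the comultiplication. -/
theorem comul_map_comul_of_comm {k C D E : Type*} [CommRing k] [AddCommGroup C] [AddCommGroup D]
    [AddCommGroup E] [Module k C] [Module k D] [Module k E] [Coalgebra k C] [Coalgebra k D]
    [Coalgebra k E] (f : C →ₗc[k] D) (g : C →ₗc[k] E)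
    (h : ∀ c, TensorProduct.map g.toLinearMap f.toLinearMap (comul c) =
      TensorProduct.comm k D E (TensorProduct.map f.toLinearMap g.toLinearMap (comul c)))
    (c : C) :
    comul (R := k) (TensorProduct.map f.toLinearMap g.toLinearMap (comul c)) =
      TensorProduct.map (TensorProduct.map f.toLinearMap g.toLinearMap ∘ₗ comul)
        (TensorProduct.map f.toLinearMap g.toLinearMap ∘ₗ comul) (comul c) := by
  have h' : TensorProduct.map g.toLinearMap f.toLinearMap ∘ₗ comul (R := k) =
      (TensorProduct.comm k D E).toLinearMap ∘ₗ
        TensorProduct.map f.toLinearMap g.toLinearMap ∘ₗ comul := LinearMap.ext h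
  -- `∑ (c₁ ⊗ c₂) ⊗ (c₃ ⊗ c₄)` is a rearrangement of `∑ c₁ ⊗ ((c₂ ⊗ c₃) ⊗ c₄)`; the two sides of
  -- the claim differ only in how `f` and `g` are applied to the middle pair `c₂ ⊗ c₃`
  have h4 : TensorProduct.map comul comul (comul (R := k) c) =
      (TensorProduct.assoc k C C (C ⊗[k] C)).symm
        ((TensorProduct.assoc k C C C).toLinearMap.lTensor C
          ((comul.rTensor C ∘ₗ comul).lTensor C (comul c))) := by
    have hnat : ∀ t : C ⊗[k] C, TensorProduct.assoc k C C (C ⊗[k] C)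
        (TensorProduct.map comul comul t) =
          (comul.lTensor C).lTensor C (TensorProduct.assoc k C C C (comul.rTensor C t)) := by
      intro t
      induction t using TensorProduct.induction_on with
      | zero => simp
      | add x y hx hy => simp only [map_add, hx, hy]
      | tmul x y =>
        rw [TensorProduct.map_tmul, LinearMap.rTensor_tmul]
        induction comul (R := k) x using TensorProduct.induction_on with
        | zero => simp
        | add x y hx hy => simp only [map_add, TensorProduct.add_tmul, hx, hy]
        | tmul p q => simp
    rw [LinearEquiv.eq_symm_apply, hnat, Coalgebra.coassoc_apply, ← LinearMap.lTensor_comp_apply,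
      ← LinearMap.lTensor_comp_apply, Coalgebra.coassoc]
  -- the map `c ⊗ ((d ⊗ e) ⊗ c') ↦ (f c ⊗ e) ⊗ (d ⊗ g c')`
  let Q : C ⊗[k] ((D ⊗[k] E) ⊗[k] C) →ₗ[k] (D ⊗[k] E) ⊗[k] (D ⊗[k] E) :=
    (TensorProduct.assoc k D E (D ⊗[k] E)).symm.toLinearMap ∘ₗ
      TensorProduct.map f.toLinearMap ((TensorProduct.assoc k E D E).toLinearMap ∘ₗ
        TensorProduct.map (TensorProduct.comm k D E).toLinearMap g.toLinearMap)
  have h5 : ∀ t : C ⊗[k] C, comul (R := k) (TensorProduct.map f.toLinearMap g.toLinearMap t) =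
      TensorProduct.tensorTensorTensorComm k D D E E
        (TensorProduct.map (TensorProduct.map f.toLinearMap f.toLinearMap)
          (TensorProduct.map g.toLinearMap g.toLinearMap)
          (TensorProduct.map comul comul t)) := by
    intro t
    induction t using TensorProduct.induction_on with
    | zero => simp
    | add x y hx hy => simp only [map_add, hx, hy]
    | tmul x y =>
      rw [TensorProduct.map_tmul, TensorProduct.map_tmul, TensorProduct.map_tmul]
      have hf : TensorProduct.map f.toLinearMap f.toLinearMap (comul x) = comul (f x) :=
        CoalgHomClass.map_comp_comul_apply f x
      have hg : TensorProduct.map g.toLinearMap g.toLinearMap (comul y) = comul (g y) :=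
        CoalgHomClass.map_comp_comul_apply g y
      rw [hf, hg]
      rfl
  have h6 : ∀ z : C ⊗[k] ((C ⊗[k] C) ⊗[k] C), TensorProduct.tensorTensorTensorComm k D D E E
        (TensorProduct.map (TensorProduct.map f.toLinearMap f.toLinearMap)
          (TensorProduct.map g.toLinearMap g.toLinearMap)
          ((TensorProduct.assoc k C C (C ⊗[k] C)).symm
            ((TensorProduct.assoc k C C C).toLinearMap.lTensor C z))) =
      Q (((TensorProduct.map f.toLinearMap g.toLinearMap).rTensor C).lTensor C z) := by
    intro z
    refine DFunLike.congr_fun (f := (TensorProduct.tensorTensorTensorComm k D D E E).toLinearMap ∘ₗ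
        (TensorProduct.map (TensorProduct.map f.toLinearMap f.toLinearMap)
          (TensorProduct.map g.toLinearMap g.toLinearMap)) ∘ₗ
          (TensorProduct.assoc k C C (C ⊗[k] C)).symm.toLinearMap ∘ₗ
            ((TensorProduct.assoc k C C C).toLinearMap.lTensor C)) (g := Q ∘ₗ
              ((TensorProduct.map f.toLinearMap g.toLinearMap).rTensor C).lTensor C) ?_ z
    ext x y w v
    rfl
  have h7 : ∀ z : C ⊗[k] ((C ⊗[k] C) ⊗[k] C),
      TensorProduct.map (TensorProduct.map f.toLinearMap g.toLinearMap)
          (TensorProduct.map f.toLinearMap g.toLinearMap)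
          ((TensorProduct.assoc k C C (C ⊗[k] C)).symm
            ((TensorProduct.assoc k C C C).toLinearMap.lTensor C z)) =
      Q (((((TensorProduct.comm k D E).symm.toLinearMap) ∘ₗ
        TensorProduct.map g.toLinearMap f.toLinearMap).rTensor C).lTensor C z) := by
    intro z
    refine DFunLike.congr_fun (f := (TensorProduct.map
        (TensorProduct.map f.toLinearMap g.toLinearMap)
          (TensorProduct.map f.toLinearMap g.toLinearMap)) ∘ₗ
          (TensorProduct.assoc k C C (C ⊗[k] C)).symm.toLinearMap ∘ₗ
            ((TensorProduct.assoc k C C C).toLinearMap.lTensor C)) (g := Q ∘ₗ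
              ((((TensorProduct.comm k D E).symm.toLinearMap) ∘ₗ
        TensorProduct.map g.toLinearMap f.toLinearMap).rTensor C).lTensor C) ?_ z
    ext x y w v
    rfl
  rw [h5, TensorProduct.map_comp, LinearMap.comp_apply, h4, h6, h7,
    ← LinearMap.lTensor_comp_apply, ← LinearMap.lTensor_comp_apply, ← LinearMap.comp_assoc,
    ← LinearMap.comp_assoc, ← LinearMap.rTensor_comp, ← LinearMap.rTensor_comp,
    LinearMap.comp_assoc, h', LinearEquiv.symm_comp_assoc]

namespace MatchedPair

open Coalgebra HopfAlgebra

variable {k : Type*} [Field k] {A : Type u} {B : Type v} [Ring A] [Ring B]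
  [HopfAlgebra k A] [HopfAlgebra k B] (M : MatchedPair k A B)

instance : Coalgebra k M.DoubleCross := inferInstanceAs (Coalgebra k (A ⊗[k] B))

/-- The identity of `A ⊗ B`, as a linear equivalence onto the double cross product. -/
def ofTensor : A ⊗[k] B ≃ₗ[k] M.DoubleCross := LinearEquiv.refl k (A ⊗[k] B)

theorem inl_apply (a : A) : M.inl a = M.pair a 1 := rfl

theorem inr_apply (b : B) : M.inr b = M.pair 1 b := rfl

theorem inr_mul_inl (a : A) (b : B) : M.inr b * M.inl a = M.ofTensor (M.twist (b ⊗ₜ a)) := by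
  rw [inl_apply, inr_apply, pair_mul_pair, LinearMap.mulLeft_one, LinearMap.mulRight_one,
    TensorProduct.map_id]
  rfl

theorem inl_mul_inr (a : A) (b : B) : M.inl a * M.inr b = M.ofTensor (a ⊗ₜ b) := by
  rw [inl_apply, inr_apply, pair_mul_pair, twist_one_left, TensorProduct.map_tmul,
    LinearMap.mulLeft_apply, LinearMap.mulRight_apply, mul_one, one_mul]
  rfl

@[elab_as_elim]
theorem induction_inl_mul_inr {p : M.DoubleCross → Prop} (h : ∀ a b, p (M.inl a * M.inr b))
    (hadd : ∀ x y, p x → p y → p (x + y)) (x : M.DoubleCross) : p x := by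
  obtain ⟨z, rfl⟩ := M.ofTensor.surjective x
  induction z using TensorProduct.induction_on with
  | zero =>
    have := h 0 0
    rwa [inl_mul_inr, TensorProduct.tmul_zero] at this
  | add x y hx hy =>
    rw [map_add]
    exact hadd _ _ hx hy
  | tmul a b =>
    rw [← inl_mul_inr]
    exact h a b

theorem counit_ofTensor (z : A ⊗[k] B) :
    counit (R := k) (M.ofTensor z) = counit (R := k) z := rfl

theorem comul_ofTensor (z : A ⊗[k] B) : comul (R := k) (M.ofTensor z) =
    TensorProduct.map M.ofTensor.toLinearMap M.ofTensor.toLinearMap (comul z) := by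
  refine Eq.symm ?_
  exact DFunLike.congr_fun (TensorProduct.map_id (R := k) (M := A ⊗[k] B) (N := A ⊗[k] B)) _

theorem counit_inl_mul_inr (a : A) (b : B) :
    counit (R := k) (M.inl a * M.inr b) = counit (R := k) a * counit (R := k) b := by
  rw [inl_mul_inr, counit_ofTensor, TensorProduct.counit_tmul, smul_eq_mul, mul_comm]

theorem comul_inl_mul_inr (a : A) (b : B) : comul (R := k) (M.inl a * M.inr b) =
    Algebra.TensorProduct.map M.inl M.inl (comul a) *
      Algebra.TensorProduct.map M.inr M.inr (comul b) := by
  rw [inl_mul_inr, comul_ofTensor, TensorProduct.comul_tmul]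
  induction comul (R := k) a using TensorProduct.induction_on with
  | zero => simp
  | add x y hx hy => simp only [map_add, add_mul, TensorProduct.add_tmul, hx, hy]
  | tmul x y =>
    induction comul (R := k) b using TensorProduct.induction_on with
    | zero => simp
    | add x y hx hy => simp only [map_add, mul_add, TensorProduct.tmul_add, hx, hy]
    | tmul z w => simp [inl_mul_inr]

theorem comul_inl (a : A) :
    comul (R := k) (M.inl a) = Algebra.TensorProduct.map M.inl M.inl (comul a) := by
  simpa using M.comul_inl_mul_inr a 1

theorem comul_inr (b : B) :
    comul (R := k) (M.inr b) = Algebra.TensorProduct.map M.inr M.inr (comul b) := by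
  simpa using M.comul_inl_mul_inr 1 b

theorem counit_inl (a : A) : counit (R := k) (M.inl a) = counit (R := k) a := by
  simpa using M.counit_inl_mul_inr a 1

theorem counit_inr (b : B) : counit (R := k) (M.inr b) = counit (R := k) b := by
  simpa using M.counit_inl_mul_inr 1 b

/-- This is where the compatibility `∑ (b₁ ◁ a₁) ⊗ (b₂ ▷ a₂) = ∑ (b₂ ◁ a₂) ⊗ (b₁ ▷ a₁)` enters. -/
theorem comul_inr_mul_inl (a : A) (b : B) :
    comul (R := k) (M.inr b * M.inl a) = comul (R := k) (M.inr b) * comul (R := k) (M.inl a) := by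
  have h := comul_map_comul_of_comm M.left M.right
    (fun c => by
      induction c using TensorProduct.induction_on with
      | zero => simp
      | add x y hx hy => simp only [map_add, hx, hy]
      | tmul b a => exact M.right_left_comm b a) (b ⊗ₜ a)
  rw [inr_mul_inl, comul_ofTensor, twist_tmul, h, comul_inr, comul_inl, TensorProduct.comul_tmul]
  induction comul (R := k) b using TensorProduct.induction_on with
  | zero => simp
  | add x y hx hy => simp only [map_add, add_mul, TensorProduct.add_tmul, hx, hy]
  | tmul x y =>
    induction comul (R := k) a using TensorProduct.induction_on with
    | zero => simp
    | add x y hx hy => simp only [map_add, mul_add, TensorProduct.tmul_add, hx, hy]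
    | tmul z w =>
      simp only [Algebra.TensorProduct.map_tmul, Algebra.TensorProduct.tmul_mul_tmul, inr_mul_inl]
      rfl

theorem counit_inr_mul_inl (a : A) (b : B) : counit (R := k) (M.inr b * M.inl a) =
    counit (R := k) (M.inr b) * counit (R := k) (M.inl a) := by
  have hT : ∀ t : (B ⊗[k] A) ⊗[k] (B ⊗[k] A), counit (R := k)
      (TensorProduct.map M.left.toLinearMap M.right.toLinearMap t) =
        counit (R := k) (TensorProduct.lid k _ (counit.rTensor _ t)) := by
    intro t
    induction t using TensorProduct.induction_on with
    | zero => simp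
    | add x y hx hy => simp only [map_add, hx, hy]
    | tmul x y =>
      have hl : counit (R := k) (M.left x) = counit (R := k) x :=
        CoalgHomClass.counit_comp_apply M.left x
      have hr : counit (R := k) (M.right y) = counit (R := k) y :=
        CoalgHomClass.counit_comp_apply M.right y
      rw [TensorProduct.map_tmul, TensorProduct.counit_tmul, LinearMap.rTensor_tmul,
        TensorProduct.lid_tmul, map_smul, smul_eq_mul, smul_eq_mul, mul_comm]
      exact congrArg₂ _ hl hr
  rw [inr_mul_inl, counit_ofTensor, twist_tmul, hT, Coalgebra.rTensor_counit_comul,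
    TensorProduct.lid_tmul, one_smul, TensorProduct.counit_tmul, counit_inr, counit_inl,
    smul_eq_mul, mul_comm]

/-- On products of the form `a · x`, `x · b` and `b · a` the comultiplication is multiplicative, and
`(a b) (a' b') = a (b a') b'`. -/
theorem comul_mul (x y : M.DoubleCross) :
    comul (R := k) (x * y) = comul (R := k) x * comul (R := k) y := by
  have hl : ∀ (a : A) (y : M.DoubleCross),
      comul (R := k) (M.inl a * y) = comul (R := k) (M.inl a) * comul (R := k) y := by
    intro a y
    induction y using M.induction_inl_mul_inr with
    | hadd y y' hy hy' => simp only [mul_add, map_add, hy, hy']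
    | h a' b =>
      rw [← mul_assoc, ← map_mul, comul_inl_mul_inr, comul_inl_mul_inr, comul_inl,
        Bialgebra.comul_mul, map_mul, mul_assoc]
  have hr : ∀ (b : B) (x : M.DoubleCross),
      comul (R := k) (x * M.inr b) = comul (R := k) x * comul (R := k) (M.inr b) := by
    intro b x
    induction x using M.induction_inl_mul_inr with
    | hadd y y' hy hy' => simp only [add_mul, map_add, hy, hy']
    | h a b' =>
      rw [mul_assoc, ← map_mul, comul_inl_mul_inr, comul_inl_mul_inr, comul_inr,
        Bialgebra.comul_mul, map_mul, mul_assoc]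
  induction x using M.induction_inl_mul_inr with
  | hadd x x' hx hx' => simp only [add_mul, map_add, hx, hx']
  | h a b =>
    induction y using M.induction_inl_mul_inr with
    | hadd y y' hy hy' => simp only [mul_add, map_add, hy, hy']
    | h a' b' =>
      rw [mul_assoc, hl, ← mul_assoc, hr, comul_inr_mul_inl, hl, hr, mul_assoc, mul_assoc]

theorem counit_mul (x y : M.DoubleCross) :
    counit (R := k) (x * y) = counit (R := k) x * counit (R := k) y := by
  have hl : ∀ (a : A) (y : M.DoubleCross),
      counit (R := k) (M.inl a * y) = counit (R := k) (M.inl a) * counit (R := k) y := by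
    intro a y
    induction y using M.induction_inl_mul_inr with
    | hadd y y' hy hy' => simp only [mul_add, map_add, hy, hy']
    | h a' b =>
      rw [← mul_assoc, ← map_mul, counit_inl_mul_inr, counit_inl_mul_inr, counit_inl,
        Bialgebra.counit_mul, mul_assoc]
  have hr : ∀ (b : B) (x : M.DoubleCross),
      counit (R := k) (x * M.inr b) = counit (R := k) x * counit (R := k) (M.inr b) := by
    intro b x
    induction x using M.induction_inl_mul_inr with
    | hadd y y' hy hy' => simp only [add_mul, map_add, hy, hy']
    | h a b' =>
      rw [mul_assoc, ← map_mul, counit_inl_mul_inr, counit_inl_mul_inr, counit_inr,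
        Bialgebra.counit_mul, mul_assoc]
  induction x using M.induction_inl_mul_inr with
  | hadd x x' hx hx' => simp only [add_mul, map_add, hx, hx']
  | h a b =>
    induction y using M.induction_inl_mul_inr with
    | hadd y y' hy hy' => simp only [mul_add, map_add, hy, hy']
    | h a' b' =>
      rw [mul_assoc, hl, ← mul_assoc, hr, counit_inr_mul_inl, hl, hr, mul_assoc, mul_assoc]

instance : Bialgebra k M.DoubleCross :=
  Bialgebra.mk' k M.DoubleCross
    (by simpa using M.counit_inl_mul_inr 1 1)
    (M.counit_mul _ _)
    (by simpa using M.comul_inl_mul_inr 1 1)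
    (M.comul_mul _ _)

/-- The antipode `a ⋈ b ↦ S(b) S(a)` of the double cross product. -/
def antipodeMap : M.DoubleCross →ₗ[k] M.DoubleCross :=
  (LinearMap.mul' k M.DoubleCross ∘ₗ TensorProduct.map (M.inr.toLinearMap ∘ₗ antipode k)
    (M.inl.toLinearMap ∘ₗ antipode k) ∘ₗ (TensorProduct.comm k A B).toLinearMap) ∘ₗ
    M.ofTensor.symm.toLinearMap

theorem antipodeMap_inl_mul_inr (a : A) (b : B) : M.antipodeMap (M.inl a * M.inr b) =
    M.inr (antipode k b) * M.inl (antipode k a) := by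
  rw [inl_mul_inr]
  rfl

open scoped Coalgebra in
instance : HopfAlgebra k M.DoubleCross where
  antipode := M.antipodeMap
  mul_antipode_rTensor_comul := by
    ext x
    induction x using M.induction_inl_mul_inr with
    | hadd x x' hx hx' => simp only [map_add, hx, hx']
    | h a b =>
      have key : ∀ j ∈ (ℛ k b).index, ∑ i ∈ (ℛ k a).index,
          M.inr (antipode k ((ℛ k b).left j)) * M.inl (antipode k ((ℛ k a).left i)) *
            (M.inl ((ℛ k a).right i) * M.inr ((ℛ k b).right j)) =
          counit (R := k) a • M.inr (antipode k ((ℛ k b).left j) * (ℛ k b).right j) := by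
        intro j _
        have h₁ : ∀ i, M.inr (antipode k ((ℛ k b).left j)) * M.inl (antipode k ((ℛ k a).left i)) *
            (M.inl ((ℛ k a).right i) * M.inr ((ℛ k b).right j)) =
            M.inr (antipode k ((ℛ k b).left j)) * M.inl (antipode k ((ℛ k a).left i) *
              (ℛ k a).right i) * M.inr ((ℛ k b).right j) := fun i => by
          simp only [map_mul, mul_assoc]
        simp only [h₁]
        rw [← Finset.sum_mul, ← Finset.mul_sum, ← map_sum, sum_antipode_mul_eq_smul]
        simp
      simp only [LinearMap.comp_apply, comul_inl_mul_inr, counit_inl_mul_inr]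
      conv_lhs => rw [← (ℛ k a).eq, ← (ℛ k b).eq]
      simp only [map_sum, Finset.sum_mul_sum, Algebra.TensorProduct.map_tmul,
        Algebra.TensorProduct.tmul_mul_tmul, LinearMap.rTensor_tmul, LinearMap.mul'_apply,
        antipodeMap_inl_mul_inr]
      rw [Finset.sum_comm, Finset.sum_congr rfl key, ← Finset.smul_sum, ← map_sum,
        sum_antipode_mul_eq_smul]
      simp [Algebra.algebraMap_eq_smul_one, mul_smul]
  mul_antipode_lTensor_comul := by
    ext x
    induction x using M.induction_inl_mul_inr with
    | hadd x x' hx hx' => simp only [map_add, hx, hx']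
    | h a b =>
      have key : ∀ i ∈ (ℛ k a).index, ∑ j ∈ (ℛ k b).index,
          M.inl ((ℛ k a).left i) * M.inr ((ℛ k b).left j) *
            (M.inr (antipode k ((ℛ k b).right j)) * M.inl (antipode k ((ℛ k a).right i))) =
          counit (R := k) b • M.inl ((ℛ k a).left i * antipode k ((ℛ k a).right i)) := by
        intro i _
        have h₁ : ∀ j, M.inl ((ℛ k a).left i) * M.inr ((ℛ k b).left j) *
            (M.inr (antipode k ((ℛ k b).right j)) * M.inl (antipode k ((ℛ k a).right i))) =
            M.inl ((ℛ k a).left i) * M.inr ((ℛ k b).left j * antipode k ((ℛ k b).right j)) *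
              M.inl (antipode k ((ℛ k a).right i)) := fun j => by
          simp only [map_mul, mul_assoc]
        simp only [h₁]
        rw [← Finset.sum_mul, ← Finset.mul_sum, ← map_sum, sum_mul_antipode_eq_smul]
        simp
      simp only [LinearMap.comp_apply, comul_inl_mul_inr, counit_inl_mul_inr]
      conv_lhs => rw [← (ℛ k a).eq, ← (ℛ k b).eq]
      simp only [map_sum, Finset.sum_mul_sum, Algebra.TensorProduct.map_tmul,
        Algebra.TensorProduct.tmul_mul_tmul, LinearMap.lTensor_tmul, LinearMap.mul'_apply,
        antipodeMap_inl_mul_inr]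
      rw [Finset.sum_congr rfl key, ← Finset.smul_sum, ← map_sum,
        sum_mul_antipode_eq_smul]
      simp [Algebra.algebraMap_eq_smul_one, mul_smul, smul_comm (counit (R := k) a)]

instance [FiniteDimensional k A] [FiniteDimensional k B] : FiniteDimensional k M.DoubleCross :=
  inferInstanceAs (FiniteDimensional k (A ⊗[k] B))

/-- The inclusion of `A` into `A ⋈ B`, as a homomorphism of bialgebras. -/
def inlBialgHom : A →ₐc[k] M.DoubleCross :=
  BialgHom.ofAlgHom M.inl (AlgHom.ext M.counit_inl) (AlgHom.ext fun a => (M.comul_inl a).symm)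

/-- The inclusion of `B` into `A ⋈ B`, as a homomorphism of bialgebras. -/
def inrBialgHom : B →ₐc[k] M.DoubleCross :=
  BialgHom.ofAlgHom M.inr (AlgHom.ext M.counit_inr) (AlgHom.ext fun b => (M.comul_inr b).symm)

theorem inlBialgHom_toAlgHom : (M.inlBialgHom : A →ₐ[k] M.DoubleCross) = M.inl := rfl

theorem inrBialgHom_toAlgHom : (M.inrBialgHom : B →ₐ[k] M.DoubleCross) = M.inr := rfl

/-- The map `a ⋈ b ↦ ε(a) b`, which identifies `H/A⁺H` with `B`. -/
def projRight : M.DoubleCross →ₗ[k] B :=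
  (TensorProduct.lid k B).toLinearMap ∘ₗ counit.rTensor B ∘ₗ M.ofTensor.symm.toLinearMap

/-- The map `a ⋈ b ↦ ε(b) a`, which identifies `H/HB⁺` with `A`. -/
def projLeft : M.DoubleCross →ₗ[k] A :=
  (TensorProduct.rid k A).toLinearMap ∘ₗ counit.lTensor A ∘ₗ M.ofTensor.symm.toLinearMap

theorem projRight_inl_mul_inr (a : A) (b : B) :
    M.projRight (M.inl a * M.inr b) = counit (R := k) a • b := by
  rw [inl_mul_inr]
  simp [projRight]

theorem projLeft_inl_mul_inr (a : A) (b : B) :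
    M.projLeft (M.inl a * M.inr b) = counit (R := k) b • a := by
  rw [inl_mul_inr]
  simp [projLeft]

theorem projRight_inl_mul (a : A) (x : M.DoubleCross) :
    M.projRight (M.inl a * x) = counit (R := k) a • M.projRight x := by
  induction x using M.induction_inl_mul_inr with
  | hadd x x' hx hx' => simp only [mul_add, map_add, smul_add, hx, hx']
  | h a' b =>
    rw [← mul_assoc, ← map_mul, projRight_inl_mul_inr, projRight_inl_mul_inr,
      Bialgebra.counit_mul, mul_smul]

theorem projLeft_mul_inr (b : B) (x : M.DoubleCross) :
    M.projLeft (x * M.inr b) = counit (R := k) b • M.projLeft x := by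
  induction x using M.induction_inl_mul_inr with
  | hadd x x' hx hx' => simp only [add_mul, map_add, smul_add, hx, hx']
  | h a b' =>
    rw [mul_assoc, ← map_mul, projLeft_inl_mul_inr, projLeft_inl_mul_inr,
      Bialgebra.counit_mul, mul_comm, mul_smul]

/-- Under `H/A⁺H = B`, the right action of `A` is `◁`. -/
theorem projRight_inr_mul_inl (a : A) (b : B) :
    M.projRight (M.inr b * M.inl a) = M.right (b ⊗ₜ a) := by
  have hT : ∀ t : (B ⊗[k] A) ⊗[k] (B ⊗[k] A), M.projRight (M.ofTensor
      (TensorProduct.map M.left.toLinearMap M.right.toLinearMap t)) =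
        M.right (TensorProduct.lid k _ (counit.rTensor _ t)) := by
    intro t
    induction t using TensorProduct.induction_on with
    | zero => simp
    | add x y hx hy => simp only [map_add, hx, hy]
    | tmul x y =>
      have hl : counit (R := k) (M.left x) = counit (R := k) x :=
        CoalgHomClass.counit_comp_apply M.left x
      rw [TensorProduct.map_tmul, ← inl_mul_inr, projRight_inl_mul_inr, LinearMap.rTensor_tmul,
        TensorProduct.lid_tmul, map_smul, ← hl]
      rfl
  rw [inr_mul_inl, twist_tmul, hT, Coalgebra.rTensor_counit_comul, TensorProduct.lid_tmul, one_smul]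

/-- Under `H/HB⁺ = A`, the left action of `B` is `▷`. -/
theorem projLeft_inr_mul_inl (a : A) (b : B) :
    M.projLeft (M.inr b * M.inl a) = M.left (b ⊗ₜ a) := by
  have hT : ∀ t : (B ⊗[k] A) ⊗[k] (B ⊗[k] A), M.projLeft (M.ofTensor
      (TensorProduct.map M.left.toLinearMap M.right.toLinearMap t)) =
        M.left (TensorProduct.rid k _ (counit.lTensor _ t)) := by
    intro t
    induction t using TensorProduct.induction_on with
    | zero => simp
    | add x y hx hy => simp only [map_add, hx, hy]
    | tmul x y =>
      have hr : counit (R := k) (M.right y) = counit (R := k) y :=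
        CoalgHomClass.counit_comp_apply M.right y
      rw [TensorProduct.map_tmul, ← inl_mul_inr, projLeft_inl_mul_inr, LinearMap.lTensor_tmul,
        TensorProduct.rid_tmul, map_smul, ← hr]
      rfl
  rw [inr_mul_inl, twist_tmul, hT, Coalgebra.lTensor_counit_comul, TensorProduct.rid_tmul, one_smul]

open HopfExtension

theorem leftAug_inl : leftAug M.inlBialgHom = LinearMap.ker M.projRight := by
  refine le_antisymm ((leftAug_le_iff _ _).2 M.projRight_inl_mul) fun x hx => ?_
  have key : ∀ x : M.DoubleCross,
      (leftAug M.inlBialgHom).mkQ x = (leftAug M.inlBialgHom).mkQ (M.inr (M.projRight x)) := by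
    intro x
    induction x using M.induction_inl_mul_inr with
    | hadd x x' hx hx' => simp only [map_add, hx, hx']
    | h a b =>
      rw [projRight_inl_mul_inr, map_smul, map_smul]
      exact mkQ_leftAug M.inlBialgHom a (M.inr b)
  rw [← Submodule.ker_mkQ (leftAug M.inlBialgHom), LinearMap.mem_ker, key, LinearMap.mem_ker.1 hx,
    map_zero, map_zero]

theorem rightAug_inr : rightAug M.inrBialgHom = LinearMap.ker M.projLeft := by
  refine le_antisymm ((rightAug_le_iff _ _).2 M.projLeft_mul_inr) fun x hx => ?_
  have key : ∀ x : M.DoubleCross,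
      (rightAug M.inrBialgHom).mkQ x = (rightAug M.inrBialgHom).mkQ (M.inl (M.projLeft x)) := by
    intro x
    induction x using M.induction_inl_mul_inr with
    | hadd x x' hx hx' => simp only [map_add, hx, hx']
    | h a b =>
      rw [projLeft_inl_mul_inr, map_smul, map_smul]
      exact mkQ_rightAug M.inrBialgHom b (M.inl a)
  rw [← Submodule.ker_mkQ (rightAug M.inrBialgHom), LinearMap.mem_ker, key, LinearMap.mem_ker.1 hx,
    map_zero, map_zero]

theorem rightAug_inl_le_iff : rightAug M.inlBialgHom ≤ leftAug M.inlBialgHom ↔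
    M.RightTrivial := by
  rw [leftAug_inl, rightAug_le_iff]
  change (∀ (a : A) (h : M.DoubleCross),
    M.projRight (h * M.inl a) = counit (R := k) a • M.projRight h) ↔ _
  constructor
  · intro h b a
    have hb : M.projRight (M.inr b) = b := by simpa using M.projRight_inl_mul_inr 1 b
    rw [← projRight_inr_mul_inl, h, hb]
  · intro h a x
    induction x using M.induction_inl_mul_inr with
    | hadd x x' hx hx' => simp only [add_mul, map_add, smul_add, hx, hx']
    | h a' b =>
      rw [mul_assoc, projRight_inl_mul, projRight_inr_mul_inl, h, projRight_inl_mul_inr, smul_comm]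

theorem leftAug_inr_le_iff : leftAug M.inrBialgHom ≤ rightAug M.inrBialgHom ↔
    M.LeftTrivial := by
  rw [rightAug_inr, leftAug_le_iff]
  change (∀ (b : B) (h : M.DoubleCross),
    M.projLeft (M.inr b * h) = counit (R := k) b • M.projLeft h) ↔ _
  constructor
  · intro h b a
    have ha : M.projLeft (M.inl a) = a := by simpa using M.projLeft_inl_mul_inr a 1
    rw [← projLeft_inr_mul_inl, h, ha]
  · intro h b x
    induction x using M.induction_inl_mul_inr with
    | hadd x x' hx hx' => simp only [mul_add, map_add, smul_add, hx, hx']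
    | h a b' =>
      rw [← mul_assoc, projLeft_mul_inr, projLeft_inr_mul_inl, h, projLeft_inl_mul_inr, smul_comm]

end MatchedPair

end

theorem theorem4p1 {k : Type*} [Field k] {A B : Type*} [Ring A] [Ring B] [HopfAlgebra k A]
    [HopfAlgebra k B] [FiniteDimensional k A] [FiniteDimensional k B] (M : MatchedPair k A B) :
    (RingExtension.minDepth M.inl ≤ 2 ↔ M.RightTrivial) ∧
      (RingExtension.minDepth M.inr ≤ 2 ↔ M.LeftTrivial) := by
  rw [← M.inlBialgHom_toAlgHom, ← M.inrBialgHom_toAlgHom,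
    HopfExtension.minDepth_le_two_iff_rightAug_le, HopfExtension.minDepth_le_two_iff_rightAug_le,
    HopfExtension.rightAug_le_leftAug_iff M.inrBialgHom]
  exact ⟨M.rightAug_inl_le_iff, M.leftAug_inr_le_iff⟩
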